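/- Let $(V^{4n},\langle\cdot,\cdot\rangle,\mathcal Q)$ be a Hermitian quaternionic vector space: $V$ is a real Euclidean vector space of dimension $4n$ and $\mathcal Q=\mathrm{span}_{\mathbb R}(J_1,J_2,J_3)\subset \mathrm{End}(V)$, where $J_1,J_2,J_3$ are anticommuting complex structures on $V$ with $J_1J_2=J_3$ and every element of $\mathcal Q$ is skew-symmetric. Let $S(\mathcal Q)=\{A\in\mathcal Q : A^2=-\mathrm{Id}\}$ and, for $I\in S(\mathcal Q)$, let $I^\perp=\{K\in S(\mathcal Q): IK=-KI\}$. Let $Sp(n)$ be the group of linear isometries of $V$ commuting with every element of $\mathcal Q$; it acts on the real Grassmannians of $V$ by $U\mapsto g(U)$. A subspace $U\subseteq V$ is quaternionic if $AU=U$ for all $A\in S(\mathcal Q)$; pure if it contains no nonzero quaternionic subspace; $I$-complex if $IU=U$; totally $I$-complex if moreover $U\perp JU$ for all $J\in I^\perp$. Two subspaces are Hermitian orthogonal if their quaternionifications (the $\mathbb H$-submodules of $V$ that they generate) are orthogonal. The $I^\perp$-Kähler angle of a $4$-dimensional $I$-complex subspace $U$ is the angle of isoclinicity in $[0,\pi/2]$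 of the pair $(U,KU)$ for any $K\in I^\perp$, i.e. the common angle that all nonzero vectors of $U$ make with $KU$. Let $U$ be a $2m$-dimensional pure $I$-complex subspace. A vector $\boldsymbol\theta=(\theta_1\le\dots\le\theta_{\lceil m/2\rceil})$ is an $I^\perp$-Kähler multipleangle of $U$ if $U$ is the sum of pairwise Hermitian orthogonal subspaces $W_1,\dots,W_{\lceil m/2\rceil}$ such that, for $i\le\lfloor m/2\rfloor$, $W_i$ is a $4$-dimensional pure $I$-complex subspace with $I^\perp$-Kähler angle $\theta_i$, and, if $m$ is odd, the last addend is a totally $I$-complex $2$-plane and the last entry of $\boldsymbol\theta$ is $\pi/2$. **Theorem.** Let $I\in S(\mathcal Q)$ and $m\ge 0$. 1. Every $2m$-dimensional pure $I$-complex subspace $U$ of $V$ has exactly one $I^\perp$-Kähler multipleangle $\boldsymbol\theta^{I^\perp}(U)$. 2. For every $\boldsymbol\theta$, $Sp(n)$ acts transitively on the set $Gr^{\mathbb R}_{(I,\boldsymbol\theta)}(2m,4n)$ of $2m$-dimensional pure $I$-complex subspaces of $V$ with $I^\perp$-Kähler multipleangle $\boldsymbol\theta$, and this set, if it is nonempty,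 is exactly one $Sp(n)$-orbit in the Grassmannian $Gr^{\mathbb R}(2m,4n)$: for each $U\in Gr^{\mathbb R}_{(I,\boldsymbol\theta)}(2m,4n)$ one has $Sp(n)\cdot U=Gr^{\mathbb R}_{(I,\boldsymbol\theta)}(2m,4n)$. So the pair $(I,\boldsymbol\theta^{I^\perp}(U))$ determines the $Sp(n)$-orbit of $U$. -/

import Mathlib

open scoped RealInnerProductSpace

namespace HermQuat

section Structures

variable {V : Type*} [NormedAddCommGroup V] [InnerProductSpace ℝ V]

/-- A hypercomplex structure on `V`: a triple of anticommuting complex structures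
with `J₁ J₂ = J₃`. -/
structure IsHypercomplex (J₁ J₂ J₃ : Module.End ℝ V) : Prop where
  sq₁ : J₁ * J₁ = -1
  sq₂ : J₂ * J₂ = -1
  sq₃ : J₃ * J₃ = -1
  anti₁₂ : J₁ * J₂ = -(J₂ * J₁)
  anti₁₃ : J₁ * J₃ = -(J₃ * J₁)
  anti₂₃ : J₂ * J₃ = -(J₃ * J₂)
  mul₁₂ : J₁ * J₂ = J₃

/-- `Q` is a quaternionic structure on `V` (the real span of a hypercomplex structure) with
respect to which the scalar product of `V` is Hermitian (every element of `Q` is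
skew-symmetric). -/
structure IsHermitianQuaternionic (Q : Submodule ℝ (Module.End ℝ V)) : Prop where
  exists_basis : ∃ J₁ J₂ J₃ : Module.End ℝ V,
    IsHypercomplex J₁ J₂ J₃ ∧ Q = Submodule.span ℝ {J₁, J₂, J₃}
  skew : ∀ A ∈ Q, ∀ x y : V, ⟪A x, y⟫ = -⟪x, A y⟫

/-- `S(Q)`: the complex structures belonging to `Q`. Since
`(a J₁ + b J₂ + c J₃)² = -(a² + b² + c²)`, this is the unit 2-sphere of `Q` when `V ≠ 0`. -/
def complexStructures (Q : Submodule ℝ (Module.End ℝ V)) : Set (Module.End ℝ V) :=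
  {A | A ∈ Q ∧ A * A = -1}

/-- `I^⊥`: the complex structures of `Q` that anticommute with `I`, i.e. the circle
`{β J + γ K | β² + γ² = 1}` for any hypercomplex basis `(I, J, K)` of `Q`. -/
def perp (Q : Submodule ℝ (Module.End ℝ V)) (I : Module.End ℝ V) : Set (Module.End ℝ V) :=
  {K | K ∈ complexStructures Q ∧ I * K = -(K * I)}

/-- `U` is quaternionic: `A U = U` for every `A ∈ S(Q)`. -/
def IsQuaternionic (Q : Submodule ℝ (Module.End ℝ V)) (U : Submodule ℝ V) : Prop :=
  ∀ A ∈ complexStructures Q, U.map A = U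

/-- `U` is pure: it contains no nonzero quaternionic subspace. -/
def IsPure (Q : Submodule ℝ (Module.End ℝ V)) (U : Submodule ℝ V) : Prop :=
  ∀ W : Submodule ℝ V, W ≤ U → IsQuaternionic Q W → W = ⊥

/-- `U` is `I`-complex: `I U = U`. -/
def IsComplex (I : Module.End ℝ V) (U : Submodule ℝ V) : Prop :=
  U.map I = U

/-- `U` is totally `I`-complex: it is `I`-complex and `U` is strictly orthogonal to `J U`
for every `J ∈ I^⊥`. -/
def IsTotallyComplex (Q : Submodule ℝ (Module.End ℝ V)) (I : Module.End ℝ V)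
    (U : Submodule ℝ V) : Prop :=
  IsComplex I U ∧ ∀ J ∈ perp Q I, U ⟂ U.map J

/-- The quaternionification of `U`: its span over the quaternions `ℝ ⊕ Q`. -/
def quaternionification (Q : Submodule ℝ (Module.End ℝ V)) (U : Submodule ℝ V) :
    Submodule ℝ V :=
  U ⊔ ⨆ A ∈ Q, U.map A

/-- Hermitian orthogonality: the quaternionifications are strictly orthogonal. -/
def HermitianOrthogonal (Q : Submodule ℝ (Module.End ℝ V)) (U W : Submodule ℝ V) : Prop :=
  quaternionification Q U ⟂ quaternionification Q W

/-- `Sp(n)`: the group of linear isometries of `V` commuting with `Q`, equivalently with all unit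
quaternions `a + A` (such isometries automatically have determinant 1). -/
def Sp (Q : Submodule ℝ (Module.End ℝ V)) : Subgroup (V ≃ₗᵢ[ℝ] V) where
  carrier := {g | ∀ A ∈ Q, ∀ x : V, g (A x) = A (g x)}
  one_mem' := fun _ _ _ => rfl
  mul_mem' := by
    intro g h hg hh A hA x
    change g (h (A x)) = A (g (h x))
    rw [hh A hA, hg A hA]
  inv_mem' := by
    intro g hg A hA x
    change g.symm (A x) = A (g.symm x)
    rw [LinearIsometryEquiv.symm_apply_eq, hg A hA, LinearIsometryEquiv.apply_symm_apply]

/-- The orbit of a subspace `U` under the action `g • U = g(U)` of `Sp(n)`. -/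
def spOrbit (Q : Submodule ℝ (Module.End ℝ V)) (U : Submodule ℝ V) : Set (Submodule ℝ V) :=
  {W | ∃ g ∈ Sp Q, U.map (g.toLinearEquiv : V →ₗ[ℝ] V) = W}

end Structures

section Angles

variable {V : Type*} [NormedAddCommGroup V] [InnerProductSpace ℝ V] [FiniteDimensional ℝ V]

/-- `A` and `B` are isoclinic with angle of isoclinicity `φ ∈ [0, π/2]`: they have the same
dimension and every nonzero vector of `A` makes the angle `φ` with its orthogonal projection
on `B` (the angle with a zero projection is `π/2`). -/
def IsIsoclinic (A B : Submodule ℝ V) (φ : ℝ) : Prop :=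
  Module.finrank ℝ A = Module.finrank ℝ B ∧ φ ∈ Set.Icc 0 (Real.pi / 2) ∧
    ∀ x ∈ A, x ≠ 0 → InnerProductGeometry.angle x (B.starProjection x) = φ

/-- `φ` is the `I^⊥`-Kähler angle of the 4-dimensional `I`-complex subspace `U`: the angle of
isoclinicity of the pair `(U, K U)` for any `K ∈ I^⊥`. -/
def IsKahlerAngle (Q : Submodule ℝ (Module.End ℝ V)) (I : Module.End ℝ V)
    (U : Submodule ℝ V) (φ : ℝ) : Prop :=
  ∀ K ∈ perp Q I, IsIsoclinic U (U.map K) φ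

/-- `θ` is an `I^⊥`-Kähler multipleangle of the `2m`-dimensional subspace `U`. The vector `θ` is
in increasing order and there is a Hermitian orthogonal decomposition of `U` in which the first
`⌊m/2⌋` addends are 4-dimensional pure `I`-complex subspaces with `I^⊥`-Kähler angles `θ i`;
when `m` is odd there is one more addend, a totally `I`-complex 2-plane, and the
corresponding last entry of `θ` is `π/2`. -/
def IsMultipleangle (Q : Submodule ℝ (Module.End ℝ V)) (I : Module.End ℝ V) (m : ℕ)
    (U : Submodule ℝ V) (θ : Fin ((m + 1) / 2) → ℝ) : Prop :=
  Monotone θ ∧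
  ∃ W : Fin ((m + 1) / 2) → Submodule ℝ V,
    (∀ i : Fin ((m + 1) / 2), (i : ℕ) < m / 2 →
      Module.finrank ℝ (W i) = 4 ∧ IsComplex I (W i) ∧ IsPure Q (W i) ∧
        IsKahlerAngle Q I (W i) (θ i)) ∧
    (∀ i : Fin ((m + 1) / 2), m / 2 ≤ (i : ℕ) →
      Module.finrank ℝ (W i) = 2 ∧ IsTotallyComplex Q I (W i) ∧ θ i = Real.pi / 2) ∧
    (∀ i j, i ≠ j → HermitianOrthogonal Q (W i) (W j)) ∧
    ⨆ i, W i = U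

/-- The set of `2m`-dimensional pure `I`-complex subspaces of `V`. -/
def pureComplexGr (Q : Submodule ℝ (Module.End ℝ V)) (I : Module.End ℝ V) (m : ℕ) :
    Set (Submodule ℝ V) :=
  {U | Module.finrank ℝ U = 2 * m ∧ IsPure Q U ∧ IsComplex I U}

/-- The set of `2m`-dimensional pure `I`-complex subspaces of `V` with `I^⊥`-Kähler
multipleangle `θ`. -/
def multipleangleGr (Q : Submodule ℝ (Module.End ℝ V)) (I : Module.End ℝ V) (m : ℕ)
    (θ : Fin ((m + 1) / 2) → ℝ) : Set (Submodule ℝ V) :=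
  {U | U ∈ pureComplexGr Q I m ∧ IsMultipleangle Q I m U θ}

end Angles

end HermQuat

/-! Complete `I` to a pair `I`, `J` of anticommuting complex structures generating `Q`. For an
`I`-complex `U` with orthogonal projection `P`, everything is read off the compression `A = P ∘ J`
on `U`, which is skew-symmetric and anticommutes with `I`. A 4-dimensional block has `I^⊥`-Kähler
angle `θ` exactly when `‖A x‖ = cos θ * ‖x‖` on it, so a multipleangle records the singular values
of `A`, each `cos θ` being carried by a real 4-space; an odd leftover plane has value `0`.

Existence (`exists_isBlockSequence`): a unit `x` maximising `‖A x‖` and its partner `y = A x / c`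
span an `A`-stable block over the `I`-complex numbers; its complement in `U` is Hermitian orthogonal
to it, and induction applies. Uniqueness (`angle_le`) is a Courant–Fischer dimension count.

Orbits: purity forces `sin θ > 0`, so a block is spanned over the `I`-complex numbers by `x` and
`cos θ • J x + sin θ • z` with `x`, `z` quaternionically orthonormal (`IsAdaptedTo.exists_frame`).
Two subspaces with the same angles thus have frames of the same shape, and some element of `Sp(n)`
carries one frame to the other (`exists_isometry`). Conversely, `Sp(n)` preserves all the data. -/

namespace HermQuat

/-! ### Adapted pairs generating the quaternionic structure. -/

section AdaptedPair

variable {V : Type*} [NormedAddCommGroup V] [InnerProductSpace ℝ V]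

/-- Two anticommuting skew-symmetric complex structures, generating a quaternionic structure. -/
structure IsAdaptedPair (I J : Module.End ℝ V) : Prop where
  II : ∀ x, I (I x) = -x
  JJ : ∀ x, J (J x) = -x
  JI : ∀ x, J (I x) = -I (J x)
  skewI : ∀ x y : V, ⟪I x, y⟫ = -⟪x, I y⟫
  skewJ : ∀ x y : V, ⟪J x, y⟫ = -⟪x, J y⟫

namespace IsAdaptedPair

variable {I J : Module.End ℝ V}

theorem inner_I_I (h : IsAdaptedPair I J) (x y : V) : ⟪I x, I y⟫ = ⟪x, y⟫ := by
  rw [h.skewI, h.II, inner_neg_right, neg_neg]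

theorem inner_J_J (h : IsAdaptedPair I J) (x y : V) : ⟪J x, J y⟫ = ⟪x, y⟫ := by
  rw [h.skewJ, h.JJ, inner_neg_right, neg_neg]

theorem norm_I (h : IsAdaptedPair I J) (x : V) : ‖I x‖ = ‖x‖ := by
  rw [norm_eq_sqrt_real_inner, h.inner_I_I, ← norm_eq_sqrt_real_inner]

theorem norm_J (h : IsAdaptedPair I J) (x : V) : ‖J x‖ = ‖x‖ := by
  rw [norm_eq_sqrt_real_inner, h.inner_J_J, ← norm_eq_sqrt_real_inner]

theorem inner_I_self (h : IsAdaptedPair I J) (x : V) : ⟪x, I x⟫ = 0 := by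
  have := h.skewI x x
  rw [real_inner_comm] at this
  linarith

theorem inner_J_self (h : IsAdaptedPair I J) (x : V) : ⟪x, J x⟫ = 0 := by
  have := h.skewJ x x
  rw [real_inner_comm] at this
  linarith

theorem inner_I_J_self (h : IsAdaptedPair I J) (x : V) : ⟪x, I (J x)⟫ = 0 := by
  have h1 : ⟪x, I (J x)⟫ = -⟪I x, J x⟫ := by rw [h.skewI, neg_neg]
  have h2 : ⟪I x, J x⟫ = -⟪J (I x), x⟫ := by rw [h.skewJ, neg_neg]
  rw [h.JI, inner_neg_left, neg_neg, real_inner_comm] at h2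
  linarith [real_inner_comm (I x) (J x), real_inner_comm x (I (J x))]

theorem I_mem_sup_map (h : IsAdaptedPair I J) {W : Submodule ℝ V} (hW : ∀ x ∈ W, I x ∈ W) {y : V}
    (hy : y ∈ W ⊔ W.map J) : I y ∈ W ⊔ W.map J := by
  obtain ⟨u, hu, _, ⟨v, hv, rfl⟩, rfl⟩ := Submodule.mem_sup.1 hy
  rw [map_add]
  refine Submodule.add_mem_sup (hW u hu) ⟨-I v, W.neg_mem (hW v hv), ?_⟩
  rw [map_neg, h.JI, neg_neg]

theorem J_mem_sup_map (h : IsAdaptedPair I J) {W : Submodule ℝ V} {y : V}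
    (hy : y ∈ W ⊔ W.map J) : J y ∈ W ⊔ W.map J := by
  obtain ⟨u, hu, _, ⟨v, hv, rfl⟩, rfl⟩ := Submodule.mem_sup.1 hy
  rw [map_add, add_comm, h.JJ]
  exact Submodule.add_mem_sup (W.neg_mem hv) ⟨u, hu, rfl⟩

/-- `J` is a skew isometry, so the four pairings between `U + J U` and `W + J W` reduce to these
two. -/
theorem inner_eq_zero_of_mem_sup_map (h : IsAdaptedPair I J) {U W : Submodule ℝ V}
    (h1 : ∀ x ∈ U, ∀ y ∈ W, ⟪x, y⟫ = 0) (h2 : ∀ x ∈ U, ∀ y ∈ W, ⟪x, J y⟫ = 0) {x y : V}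
    (hx : x ∈ U ⊔ U.map J) (hy : y ∈ W ⊔ W.map J) : ⟪x, y⟫ = 0 := by
  obtain ⟨u, hu, _, ⟨v, hv, rfl⟩, rfl⟩ := Submodule.mem_sup.1 hx
  obtain ⟨u', hu', _, ⟨v', hv', rfl⟩, rfl⟩ := Submodule.mem_sup.1 hy
  simp only [inner_add_left, inner_add_right, h.inner_J_J, h.skewJ v u']
  rw [h1 u hu u' hu', h2 u hu v' hv', h2 v hv u' hu', h1 v hv v' hv']
  simp

end IsAdaptedPair

theorem isComplex_iff {I : Module.End ℝ V} (hI : ∀ x, I (I x) = -x) {U : Submodule ℝ V} :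
    IsComplex I U ↔ ∀ x ∈ U, I x ∈ U := by
  constructor
  · intro hU x hx
    rw [← show U.map I = U from hU]
    exact Submodule.mem_map_of_mem hx
  · intro hU
    apply le_antisymm
    · rintro _ ⟨x, hx, rfl⟩
      exact hU x hx
    · intro x hx
      exact ⟨-I x, U.neg_mem (hU x hx), by rw [map_neg, hI, neg_neg]⟩

theorem mem_span_triple {Q : Submodule ℝ (Module.End ℝ V)} {A B C : Module.End ℝ V}
    (hQ : Q = Submodule.span ℝ {A, B, C}) {T : Module.End ℝ V} :
    T ∈ Q ↔ ∃ a b c : ℝ, T = a • A + b • B + c • C := by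
  rw [hQ, Submodule.mem_span_triple]
  simp only [eq_comm]

/-- `I` and `J` generate the quaternionic structure `Q`. -/
structure IsAdaptedTo (Q : Submodule ℝ (Module.End ℝ V)) (I J : Module.End ℝ V) : Prop
    extends IsAdaptedPair I J where
  span_eq : Q = Submodule.span ℝ {I, J, I * J}

/-- Two orthonormal vectors and their cross product are the rows of an orthogonal matrix; the
identities are the orthonormality of its columns. -/
theorem orthonormal_complement_identities {a b c p q r : ℝ} (hu : a ^ 2 + b ^ 2 + c ^ 2 = 1)
    (hv : p ^ 2 + q ^ 2 + r ^ 2 = 1) (huv : a * p + b * q + c * r = 0) :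
    let x := b * r - c * q
    let y := c * p - a * r
    let z := a * q - b * p
    a * a + p * p + x * x = 1 ∧ b * b + q * q + y * y = 1 ∧ c * c + r * r + z * z = 1 ∧
    a * b + p * q + x * y = 0 ∧ a * c + p * r + x * z = 0 ∧ b * c + q * r + y * z = 0 := by
  intro x y z
  have hM : (!![a, b, c; p, q, r; x, y, z] : Matrix (Fin 3) (Fin 3) ℝ) *
      (!![a, b, c; p, q, r; x, y, z] : Matrix (Fin 3) (Fin 3) ℝ).transpose = 1 := by
    have hw : x ^ 2 + y ^ 2 + z ^ 2 = 1 := by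
      have : x ^ 2 + y ^ 2 + z ^ 2 = (a ^ 2 + b ^ 2 + c ^ 2) * (p ^ 2 + q ^ 2 + r ^ 2) -
        (a * p + b * q + c * r) ^ 2 := by simp only [x, y, z]; ring
      rw [this, hu, hv, huv]; norm_num
    ext i j
    fin_cases i <;> fin_cases j <;>
      simp [Matrix.mul_apply, Fin.sum_univ_three, Matrix.transpose_apply] <;>
      linarith
  rw [mul_eq_one_comm] at hM
  have key := fun i j => congrFun (congrFun hM i) j
  simp only [Matrix.mul_apply, Fin.sum_univ_three, Matrix.transpose_apply] at key
  refine ⟨by simpa using key 0 0, by simpa using key 1 1, by simpa using key 2 2,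
    by simpa using key 0 1, by simpa using key 0 2, by simpa using key 1 2⟩

theorem exists_unit_orthogonal (a b c : ℝ) :
    ∃ p q r : ℝ, p ^ 2 + q ^ 2 + r ^ 2 = 1 ∧ a * p + b * q + c * r = 0 := by
  by_cases h : a ^ 2 + b ^ 2 = 0
  · have ha : a = 0 := by nlinarith [sq_nonneg a, sq_nonneg b]
    exact ⟨1, 0, 0, by norm_num, by simp [ha]⟩
  · have hpos : 0 < a ^ 2 + b ^ 2 := lt_of_le_of_ne (by positivity) (Ne.symm h)
    have hs := Real.sq_sqrt hpos.le
    have hs0 : Real.sqrt (a ^ 2 + b ^ 2) ≠ 0 := (Real.sqrt_pos.2 hpos).ne'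
    refine ⟨-b / Real.sqrt (a ^ 2 + b ^ 2), a / Real.sqrt (a ^ 2 + b ^ 2), 0, ?_, ?_⟩
    · field_simp
      rw [hs]; ring
    · field_simp
      ring

/-- `Q` behaves like the imaginary quaternions: a product is minus the dot product plus the cross
product. So `I` is a unit vector, any unit `J` orthogonal to it anticommutes with it, and `I * J`
completes the basis. -/
theorem exists_isAdaptedTo {Q : Submodule ℝ (Module.End ℝ V)} (hQ : IsHermitianQuaternionic Q)
    {I : Module.End ℝ V} (hI : I ∈ complexStructures Q) : ∃ J, IsAdaptedTo Q I J := by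
  -- On the zero space the coefficients of `I` are not determined, but any `J` works there.
  rcases subsingleton_or_nontrivial V with hV | hV
  · have : Subsingleton (Submodule ℝ (Module.End ℝ V)) := inferInstance
    exact ⟨0, ⟨⟨fun _ => Subsingleton.elim _ _, fun _ => Subsingleton.elim _ _,
      fun _ => Subsingleton.elim _ _, fun x y => by simp [Subsingleton.elim x 0],
      fun x y => by simp⟩, Subsingleton.elim _ _⟩⟩
  obtain ⟨⟨J₁, J₂, J₃, hJ, hspan⟩, hskew⟩ := hQ
  obtain ⟨hIQ, hI2⟩ := hI
  obtain ⟨a, b, c, rfl⟩ := (mem_span_triple hspan).1 hIQ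
  have h21 : J₂ * J₁ = -J₃ := by rw [← hJ.mul₁₂, hJ.anti₁₂, neg_neg]
  have h13 : J₁ * J₃ = -J₂ := by rw [← hJ.mul₁₂, ← mul_assoc, hJ.sq₁, neg_one_mul]
  have h31 : J₃ * J₁ = J₂ := by rw [← neg_inj, ← hJ.anti₁₃, h13]
  have h32 : J₃ * J₂ = -J₁ := by rw [← hJ.mul₁₂, mul_assoc, hJ.sq₂, mul_neg_one]
  have h23 : J₂ * J₃ = J₁ := by rw [hJ.anti₂₃, h32, neg_neg]
  have hmul : ∀ a b c p q r : ℝ, (a • J₁ + b • J₂ + c • J₃) * (p • J₁ + q • J₂ + r • J₃) =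
      (-(a * p + b * q + c * r)) • (1 : Module.End ℝ V) + (b * r - c * q) • J₁ +
        (c * p - a * r) • J₂ + (a * q - b * p) • J₃ := by
    intro a b c p q r
    simp only [add_mul, mul_add, smul_mul_assoc, mul_smul_comm, hJ.sq₁, hJ.sq₂, hJ.sq₃,
      hJ.mul₁₂, h21, h13, h31, h32, h23]
    module
  have hu : a ^ 2 + b ^ 2 + c ^ 2 = 1 := by
    rw [hmul] at hI2
    obtain ⟨v, hv⟩ := exists_ne (0 : V)
    have h1 := LinearMap.congr_fun hI2 v
    have h2 : (a ^ 2 + b ^ 2 + c ^ 2 - 1) • v = 0 := by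
      simp only [LinearMap.add_apply, LinearMap.smul_apply, Module.End.one_apply,
        LinearMap.neg_apply] at h1
      linear_combination (norm := module) (-1 : ℝ) • h1
    have := (smul_eq_zero.1 h2).resolve_right hv
    linarith
  obtain ⟨p, q, r, hv, huv⟩ := exists_unit_orthogonal a b c
  obtain ⟨e1, e2, e3, e4, e5, e6⟩ := orthonormal_complement_identities hu hv huv
  set I := a • J₁ + b • J₂ + c • J₃ with hIdef
  set J := p • J₁ + q • J₂ + r • J₃ with hJdef
  have hJQ : J ∈ Q := (mem_span_triple hspan).2 ⟨p, q, r, rfl⟩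
  have hJ2 : J * J = -1 := by
    rw [hJdef, hmul]
    rw [show p * p + q * q + r * r = 1 by linarith]
    module
  have hIJ : I * J = (b * r - c * q) • J₁ + (c * p - a * r) • J₂ + (a * q - b * p) • J₃ := by
    rw [hIdef, hJdef, hmul, huv]; module
  have hJI : J * I = -(I * J) := by
    rw [hIJ, hIdef, hJdef, hmul]
    rw [show p * a + q * b + r * c = 0 by linarith]
    module
  refine ⟨J, ⟨fun x => LinearMap.congr_fun hI2 x, fun x => LinearMap.congr_fun hJ2 x,
    fun x => LinearMap.congr_fun hJI x, hskew I hIQ, hskew J hJQ⟩, ?_⟩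
  rw [hspan]
  apply le_antisymm
  · rw [Submodule.span_le]
    -- The change of basis is orthogonal, so its inverse is its transpose: the coefficients are read
    -- down the columns.
    have m1 : J₁ = a • I + p • J + (b * r - c * q) • (I * J) := by
      rw [hIJ, hIdef, hJdef]
      linear_combination (norm := module) -(e1 • J₁) - (e4 • J₂) - (e5 • J₃)
    have m2 : J₂ = b • I + q • J + (c * p - a * r) • (I * J) := by
      rw [hIJ, hIdef, hJdef]
      linear_combination (norm := module) -(e4 • J₁) - (e2 • J₂) - (e6 • J₃)
    have m3 : J₃ = c • I + r • J + (a * q - b * p) • (I * J) := by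
      rw [hIJ, hIdef, hJdef]
      linear_combination (norm := module) -(e5 • J₁) - (e6 • J₂) - (e3 • J₃)
    rintro _ (rfl | rfl | rfl)
    · exact (mem_span_triple rfl).2 ⟨_, _, _, m1⟩
    · exact (mem_span_triple rfl).2 ⟨_, _, _, m2⟩
    · exact (mem_span_triple rfl).2 ⟨_, _, _, m3⟩
  · rw [Submodule.span_le]
    rintro _ (rfl | rfl | rfl)
    · exact (mem_span_triple rfl).2 ⟨_, _, _, rfl⟩
    · exact (mem_span_triple rfl).2 ⟨_, _, _, rfl⟩
    · exact (mem_span_triple rfl).2 ⟨_, _, _, hIJ⟩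

namespace IsAdaptedTo

variable {Q : Submodule ℝ (Module.End ℝ V)} {I J : Module.End ℝ V}

theorem mem_iff (h : IsAdaptedTo Q I J) {A : Module.End ℝ V} :
    A ∈ Q ↔ ∃ a b c : ℝ, A = a • I + b • J + c • (I * J) :=
  mem_span_triple h.span_eq

theorem left_mem (h : IsAdaptedTo Q I J) : I ∈ Q := h.mem_iff.2 ⟨1, 0, 0, by module⟩

theorem right_mem (h : IsAdaptedTo Q I J) : J ∈ Q := h.mem_iff.2 ⟨0, 1, 0, by module⟩

theorem right_mem_perp (h : IsAdaptedTo Q I J) : J ∈ perp Q I :=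
  ⟨⟨h.right_mem, LinearMap.ext h.JJ⟩, LinearMap.ext fun x => by
    simp [h.JI]⟩

/-- Anticommuting with `I` kills the `I`-coefficient, and `A * A = -1` puts the other two on the
unit circle; a nonzero vector is needed to compare scalars. -/
theorem exists_of_mem_perp (h : IsAdaptedTo Q I J) [Nontrivial V] {A : Module.End ℝ V}
    (hA : A ∈ perp Q I) :
    ∃ b c : ℝ, b ^ 2 + c ^ 2 = 1 ∧ ∀ x, A x = b • J x + c • I (J x) := by
  obtain ⟨⟨hAQ, hA2⟩, hIA⟩ := hA
  obtain ⟨a, b, c, rfl⟩ := h.mem_iff.1 hAQ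
  obtain ⟨v, hv⟩ := exists_ne (0 : V)
  have ha : a = 0 := by
    have h1 := LinearMap.congr_fun hIA v
    simp only [LinearMap.add_apply, LinearMap.smul_apply, Module.End.mul_apply,
      LinearMap.neg_apply, map_add, map_smul, h.II, h.JI, map_neg] at h1
    have h2 : a • v = 0 := by linear_combination (norm := module) (-1/2 : ℝ) • h1
    exact (smul_eq_zero.1 h2).resolve_right hv
  subst ha
  refine ⟨b, c, ?_, fun x => by simp⟩
  have h1 := LinearMap.congr_fun hA2 v
  simp only [LinearMap.add_apply, LinearMap.smul_apply, Module.End.mul_apply,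
      LinearMap.neg_apply, map_add, map_smul, h.II, h.JI, h.JJ, map_neg, Module.End.one_apply] at h1
  have h2 : (b ^ 2 + c ^ 2 - 1) • v = 0 := by linear_combination (norm := module) (-1 : ℝ) • h1
  linarith [(smul_eq_zero.1 h2).resolve_right hv]

theorem apply_mem (h : IsAdaptedTo Q I J) {W : Submodule ℝ V} (hWI : ∀ x ∈ W, I x ∈ W)
    (hWJ : ∀ x ∈ W, J x ∈ W)
    {A : Module.End ℝ V} (hA : A ∈ Q) {x : V} (hx : x ∈ W) : A x ∈ W := by
  obtain ⟨a, b, c, rfl⟩ := h.mem_iff.1 hA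
  exact W.add_mem (W.add_mem (W.smul_mem _ (hWI _ hx)) (W.smul_mem _ (hWJ _ hx)))
    (W.smul_mem _ (hWI _ (hWJ _ hx)))

theorem isQuaternionic (h : IsAdaptedTo Q I J) {W : Submodule ℝ V} (hWI : ∀ x ∈ W, I x ∈ W)
    (hWJ : ∀ x ∈ W, J x ∈ W) :
    IsQuaternionic Q W := fun _ hA =>
  (isComplex_iff fun x => LinearMap.congr_fun hA.2 x).2 fun _ hx =>
    h.apply_mem hWI hWJ hA.1 hx

theorem mem_Sp_iff (h : IsAdaptedTo Q I J) {g : V ≃ₗᵢ[ℝ] V} :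
    g ∈ Sp Q ↔ (∀ x, g (I x) = I (g x)) ∧ ∀ x, g (J x) = J (g x) := by
  constructor
  · intro hg
    exact ⟨hg I h.left_mem, hg J h.right_mem⟩
  · rintro ⟨hgI, hgJ⟩ A hA x
    obtain ⟨a, b, c, rfl⟩ := h.mem_iff.1 hA
    simp [hgI, hgJ]

theorem quaternionification_eq (h : IsAdaptedTo Q I J) {W : Submodule ℝ V}
    (hW : ∀ x ∈ W, I x ∈ W) : quaternionification Q W = W ⊔ W.map J := by
  apply le_antisymm
  · refine sup_le le_sup_left (iSup₂_le fun A hA => ?_)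
    rintro _ ⟨x, hx, rfl⟩
    exact h.apply_mem (fun _ => h.I_mem_sup_map hW) (fun _ => h.J_mem_sup_map) hA
      (Submodule.mem_sup_left hx)
  · refine sup_le_sup_left ?_ _
    exact le_iSup₂_of_le J h.right_mem le_rfl

theorem hermitianOrthogonal_iff (h : IsAdaptedTo Q I J) {U W : Submodule ℝ V}
    (hU : ∀ x ∈ U, I x ∈ U) (hW : ∀ x ∈ W, I x ∈ W) :
    HermitianOrthogonal Q U W ↔
      (∀ x ∈ U, ∀ y ∈ W, ⟪x, y⟫ = 0) ∧ ∀ x ∈ U, ∀ y ∈ W, ⟪x, J y⟫ = 0 := by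
  rw [HermitianOrthogonal, h.quaternionification_eq hU, h.quaternionification_eq hW]
  constructor
  · intro H
    exact ⟨fun x hx y hy => H.inner_eq (Submodule.mem_sup_left hx) (Submodule.mem_sup_left hy),
      fun x hx y hy => H.inner_eq (Submodule.mem_sup_left hx)
        (Submodule.mem_sup_right ⟨y, hy, rfl⟩)⟩
  · rintro ⟨h1, h2⟩
    exact Submodule.isOrtho_iff_inner_eq.2 fun x hx y hy =>
      h.inner_eq_zero_of_mem_sup_map h1 h2 hx hy

end IsAdaptedTo

end AdaptedPair

theorem finrank_map_of_sq {V : Type*} [NormedAddCommGroup V] [InnerProductSpace ℝ V]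
    {A : Module.End ℝ V} (hA : ∀ x, A (A x) = -x) (W : Submodule ℝ V) :
    Module.finrank ℝ (W.map A) = Module.finrank ℝ W := by
  exact (Submodule.equivMapOfInjective A (fun x y hxy => by
    have := congrArg A hxy
    rwa [hA, hA, neg_inj] at this) W).finrank_eq.symm

/-! ### Kähler angles as norms of the compression of `J`. -/

section Blocks

variable {V : Type*} [NormedAddCommGroup V] [InnerProductSpace ℝ V] [FiniteDimensional ℝ V]

/-- `A` is an isometry with inverse `-A`, so the projection on `A W` is the conjugate by `A` of the
projection on `W`. -/
theorem starProjection_map_of_skew {A : Module.End ℝ V} (hA : ∀ x, A (A x) = -x)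
    (hskew : ∀ x y : V, ⟪A x, y⟫ = -⟪x, A y⟫) (W : Submodule ℝ V) (x : V) :
    (W.map A).starProjection x = -A (W.starProjection (A x)) := by
  apply Submodule.eq_starProjection_of_mem_of_inner_eq_zero
  · exact (W.map A).neg_mem (Submodule.mem_map_of_mem (W.starProjection_apply_mem _))
  · rintro _ ⟨w, hw, rfl⟩
    have h1 := W.starProjection_inner_eq_zero (A x) w hw
    rw [inner_sub_left] at h1
    rw [sub_neg_eq_add, inner_add_left, hskew (W.starProjection (A x)) (A w), hA, inner_neg_right,
      neg_neg]
    have h2 := hskew x w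
    linarith

theorem cos_angle_starProjection (B : Submodule ℝ V) {x : V} (hx : x ≠ 0) :
    Real.cos (InnerProductGeometry.angle x (B.starProjection x)) =
      ‖B.starProjection x‖ / ‖x‖ := by
  rw [InnerProductGeometry.cos_angle]
  have h1 : ⟪x, B.starProjection x⟫ = ‖B.starProjection x‖ * ‖B.starProjection x‖ := by
    have := B.starProjection_inner_eq_zero x _ (B.starProjection_apply_mem x)
    rw [inner_sub_left, real_inner_self_eq_norm_mul_norm] at this
    linarith
  rw [h1]
  have hx' : ‖x‖ ≠ 0 := norm_ne_zero_iff.2 hx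
  -- A zero projection turns the cosine into `0 / 0 = 0`, in accordance with the convention that the
  -- angle is `π/2`.
  by_cases h0 : ‖B.starProjection x‖ = 0
  · simp [h0]
  · field_simp

/-- `W` is `I`-complex, and every vector of `J W` makes the angle of cosine `c` with `W`. -/
structure IsBlock (I J : Module.End ℝ V) (c : ℝ) (W : Submodule ℝ V) : Prop where
  apply_mem : ∀ x ∈ W, I x ∈ W
  norm_proj : ∀ x ∈ W, ‖W.starProjection (J x)‖ = c * ‖x‖

theorem IsAdaptedPair.starProjection_I {I J : Module.End ℝ V} (h : IsAdaptedPair I J)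
    {W : Submodule ℝ V} (hW : ∀ x ∈ W, I x ∈ W) (x : V) :
    W.starProjection (I x) = I (W.starProjection x) := by
  apply Submodule.eq_starProjection_of_mem_of_inner_eq_zero
  · exact hW _ (W.starProjection_apply_mem _)
  · intro w hw
    rw [← map_sub, h.skewI, W.starProjection_inner_eq_zero _ _ (hW w hw), neg_zero]

/-- Testing `J` alone suffices: any `K ∈ I^⊥` equals `(b + c I) J` with `b² + c² = 1`, and `b + c I`
is an isometry commuting with the projection on an `I`-complex subspace. -/
theorem IsAdaptedTo.isKahlerAngle_iff {Q : Submodule ℝ (Module.End ℝ V)} {I J : Module.End ℝ V}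
    (h : IsAdaptedTo Q I J) {W : Submodule ℝ V} (hW : ∀ x ∈ W, I x ∈ W) {φ : ℝ} :
    IsKahlerAngle Q I W φ ↔ φ ∈ Set.Icc 0 (Real.pi / 2) ∧ IsBlock I J (Real.cos φ) W := by
  constructor
  · intro H
    obtain ⟨-, hφ, hang⟩ := H J h.right_mem_perp
    refine ⟨hφ, hW, fun x hx => ?_⟩
    rcases eq_or_ne x 0 with rfl | hx0
    · simp
    have := cos_angle_starProjection (W.map J) hx0
    rw [hang x hx hx0, starProjection_map_of_skew h.JJ h.skewJ, norm_neg, h.norm_J] at this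
    rw [this, div_mul_cancel₀ _ (norm_ne_zero_iff.2 hx0)]
  · rintro ⟨hφ, -, hn⟩ A hA
    have hAA : ∀ x, A (A x) = -x := fun x => LinearMap.congr_fun hA.1.2 x
    refine ⟨(finrank_map_of_sq hAA W).symm, hφ, fun x hx hx0 => ?_⟩
    have : Nontrivial V := ⟨x, 0, hx0⟩
    obtain ⟨b, c, hbc, hAx⟩ := h.exists_of_mem_perp hA
    have hskew : ∀ x y : V, ⟪A x, y⟫ = -⟪x, A y⟫ := by
      intro x y
      have h1 : ⟪I (J x), y⟫ = -⟪x, I (J y)⟫ := by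
        rw [h.skewI, h.skewJ, h.JI, inner_neg_right, neg_neg]
      rw [hAx, hAx, inner_add_left, inner_add_right, real_inner_smul_left, real_inner_smul_left,
        real_inner_smul_right, real_inner_smul_right, h.skewJ, h1]
      ring
    have hnorm : ∀ x, ‖A x‖ = ‖x‖ := fun x => by
      rw [norm_eq_sqrt_real_inner, hskew, hAA, inner_neg_right, neg_neg,
        ← norm_eq_sqrt_real_inner]
    have hcomb : ∀ y : V, ‖b • y + c • I y‖ = ‖y‖ := fun y => by
      have : ‖b • y + c • I y‖ ^ 2 = ‖y‖ ^ 2 := by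
        rw [norm_add_sq_real, norm_smul, norm_smul, real_inner_smul_left, real_inner_smul_right,
          h.inner_I_self, h.norm_I, mul_pow, mul_pow, Real.norm_eq_abs, Real.norm_eq_abs, sq_abs,
          sq_abs]
        linear_combination (‖y‖ ^ 2) * hbc
      exact (sq_eq_sq₀ (norm_nonneg _) (norm_nonneg _)).1 this
    have hc := cos_angle_starProjection (W.map A) hx0
    have hp : ‖W.starProjection (A x)‖ = Real.cos φ * ‖x‖ := by
      rw [hAx, map_add, map_smul, map_smul, h.starProjection_I hW, hcomb, hn x hx]
    have hp' : ‖(W.map A).starProjection x‖ = Real.cos φ * ‖x‖ := by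
      rw [starProjection_map_of_skew hAA hskew, norm_neg, hnorm, hp]
    rw [hp', mul_div_cancel_right₀ _ (norm_ne_zero_iff.2 hx0)] at hc
    exact Real.injOn_cos ⟨InnerProductGeometry.angle_nonneg _ _,
      InnerProductGeometry.angle_le_pi _ _⟩ ⟨hφ.1, hφ.2.trans (by linarith [Real.pi_pos])⟩ hc

/-- Cosine `0` says `J W ⟂ W`; since `W` is `I`-complex, `I J W ⟂ W` follows, and `J`, `I J` span
`I^⊥`. -/
theorem IsAdaptedTo.isTotallyComplex_iff {Q : Submodule ℝ (Module.End ℝ V)}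
    {I J : Module.End ℝ V} (h : IsAdaptedTo Q I J) {W : Submodule ℝ V} :
    IsTotallyComplex Q I W ↔ IsBlock I J 0 W := by
  constructor
  · rintro ⟨hW, hort⟩
    refine ⟨(isComplex_iff h.II).1 hW, fun x hx => ?_⟩
    rw [zero_mul, norm_eq_zero, Submodule.starProjection_apply_eq_zero_iff]
    exact (hort J h.right_mem_perp).ge (Submodule.mem_map_of_mem hx)
  · rintro ⟨hW, hn⟩
    refine ⟨(isComplex_iff h.II).2 hW, fun A hA => ?_⟩
    rcases subsingleton_or_nontrivial V with hV | hV
    · rw [Subsingleton.elim W ⊥]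
      exact Submodule.isOrtho_bot_left
    obtain ⟨b, c, -, hAx⟩ := h.exists_of_mem_perp hA
    rw [Submodule.isOrtho_iff_inner_eq]
    rintro x hx _ ⟨y, hy, rfl⟩
    have hJy : J y ∈ Wᗮ := by
      have := hn y hy
      rwa [zero_mul, norm_eq_zero, Submodule.starProjection_apply_eq_zero_iff] at this
    have h1 := Submodule.inner_right_of_mem_orthogonal hx hJy
    have h2 := Submodule.inner_right_of_mem_orthogonal (hW x hx) hJy
    rw [h.skewI] at h2
    rw [hAx, inner_add_right, real_inner_smul_right, real_inner_smul_right, h1]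
    rw [show ⟪x, I (J y)⟫ = 0 by linarith]
    ring

end Blocks

/-! ### Norms and dimensions of orthogonal sums. -/

section OrthogonalSums

variable {V : Type*} [NormedAddCommGroup V] [InnerProductSpace ℝ V]

theorem norm_sum_sq_of_orthogonal {ι : Type*} (s : Finset ι) {w : ι → V}
    (hw : ∀ i j, i ≠ j → ⟪w i, w j⟫ = 0) : ‖∑ i ∈ s, w i‖ ^ 2 = ∑ i ∈ s, ‖w i‖ ^ 2 := by
  classical
  rw [← real_inner_self_eq_norm_sq, sum_inner]
  refine Finset.sum_congr rfl fun i hi => ?_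
  rw [inner_sum, Finset.sum_eq_single_of_mem i hi fun j _ hj => hw i j hj.symm,
    real_inner_self_eq_norm_sq]

theorem finrank_biSup_of_orthogonal [FiniteDimensional ℝ V] {ι : Type*} (s : Finset ι)
    {W : ι → Submodule ℝ V} (hW : ∀ i j, i ≠ j → W i ⟂ W j) :
    Module.finrank ℝ (⨆ i ∈ s, W i : Submodule ℝ V) = ∑ i ∈ s, Module.finrank ℝ (W i) := by
  classical
  induction s using Finset.induction_on with
  | empty => simp
  | insert a s ha ih =>
    rw [Finset.iSup_insert, Finset.sum_insert ha, ← ih, ← Submodule.finrank_sup_add_finrank_inf_eq]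
    have hd : W a ⟂ ⨆ i ∈ s, W i := by
      simp only [Submodule.isOrtho_iSup_right]
      intro i hi
      exact hW a i (fun hai => ha (hai ▸ hi))
    rw [hd.disjoint.eq_bot, finrank_bot, add_zero]

end OrthogonalSums

/-! ### Block decompositions and uniqueness of the angles. -/

section Decompositions

variable {V : Type*} [NormedAddCommGroup V] [InnerProductSpace ℝ V] [FiniteDimensional ℝ V]

/-- A decomposition of `U` into Hermitian orthogonal blocks of dimension four, with one more
totally complex plane if `m` is odd. -/
structure IsBlockDecomposition (I J : Module.End ℝ V) (m : ℕ) (U : Submodule ℝ V)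
    (θ : Fin ((m + 1) / 2) → ℝ) (W : Fin ((m + 1) / 2) → Submodule ℝ V) : Prop where
  block : ∀ i, IsBlock I J (Real.cos (θ i)) (W i)
  mem_Icc : ∀ i, θ i ∈ Set.Icc 0 (Real.pi / 2)
  finrank_eq : ∀ i, Module.finrank ℝ (W i) = if (i : ℕ) < m / 2 then 4 else 2
  last_eq : ∀ i : Fin ((m + 1) / 2), m / 2 ≤ (i : ℕ) → θ i = Real.pi / 2
  inner_eq_zero : ∀ i j, i ≠ j → ∀ x ∈ W i, ∀ y ∈ W j, ⟪x, y⟫ = 0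
  inner_J_eq_zero : ∀ i j, i ≠ j → ∀ x ∈ W i, ∀ y ∈ W j, ⟪x, J y⟫ = 0
  iSup_eq : ⨆ i, W i = U

/-- The totally complex plane becomes a block of angle `π/2`, so that all addends are handled alike.
-/
theorem IsAdaptedTo.isMultipleangle_iff {Q : Submodule ℝ (Module.End ℝ V)}
    {I J : Module.End ℝ V} (h : IsAdaptedTo Q I J) {m : ℕ} {U : Submodule ℝ V}
    {θ : Fin ((m + 1) / 2) → ℝ} :
    IsMultipleangle Q I m U θ ↔ Monotone θ ∧ ∃ W, IsBlockDecomposition I J m U θ W ∧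
      ∀ i : Fin ((m + 1) / 2), (i : ℕ) < m / 2 → IsPure Q (W i) := by
  constructor
  · rintro ⟨hmono, W, h4, h2, hort, hsup⟩
    have hcases : ∀ i : Fin ((m + 1) / 2), θ i ∈ Set.Icc 0 (Real.pi / 2) ∧
        IsBlock I J (Real.cos (θ i)) (W i) := by
      intro i
      rcases lt_or_ge (i : ℕ) (m / 2) with hi | hi
      · obtain ⟨-, hc, -, hk⟩ := h4 i hi
        exact (h.isKahlerAngle_iff ((isComplex_iff h.II).1 hc)).1 hk
      · obtain ⟨-, ht, he⟩ := h2 i hi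
        rw [he, Real.cos_pi_div_two]
        exact ⟨⟨by positivity, le_rfl⟩, h.isTotallyComplex_iff.1 ht⟩
    have hort' := fun i j hij =>
      (h.hermitianOrthogonal_iff (hcases i).2.apply_mem (hcases j).2.apply_mem).1 (hort i j hij)
    refine ⟨hmono, W, ⟨fun i => (hcases i).2, fun i => (hcases i).1, fun i => ?_,
      fun i hi => (h2 i hi).2.2, fun i j hij => (hort' i j hij).1, fun i j hij => (hort' i j hij).2,
      hsup⟩, fun i hi => (h4 i hi).2.2.1⟩
    split_ifs with hi
    · exact (h4 i hi).1
    · exact (h2 i (not_lt.1 hi)).1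
  · rintro ⟨hmono, W, H, hp⟩
    refine ⟨hmono, W, fun i hi => ⟨?_, ?_, hp i hi, ?_⟩, fun i hi => ⟨?_, ?_, H.last_eq i hi⟩,
      fun i j hij => ?_, H.iSup_eq⟩
    · rw [H.finrank_eq, if_pos hi]
    · exact (isComplex_iff h.II).2 (H.block i).apply_mem
    · exact (h.isKahlerAngle_iff (H.block i).apply_mem).2 ⟨H.mem_Icc i, H.block i⟩
    · rw [H.finrank_eq, if_neg (not_lt.2 hi)]
    · have := H.block i
      rw [H.last_eq i hi, Real.cos_pi_div_two] at this
      exact h.isTotallyComplex_iff.2 this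
    · exact (h.hermitianOrthogonal_iff (H.block i).apply_mem (H.block j).apply_mem).2
        ⟨H.inner_eq_zero i j hij, H.inner_J_eq_zero i j hij⟩

namespace IsBlockDecomposition

variable {I J : Module.End ℝ V} {m : ℕ} {U : Submodule ℝ V}
  {θ : Fin ((m + 1) / 2) → ℝ} {W : Fin ((m + 1) / 2) → Submodule ℝ V}

theorem le (H : IsBlockDecomposition I J m U θ W) (i : Fin ((m + 1) / 2)) : W i ≤ U :=
  H.iSup_eq ▸ le_iSup W i

theorem isOrtho (H : IsBlockDecomposition I J m U θ W) (i j : Fin ((m + 1) / 2)) (hij : i ≠ j) :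
    W i ⟂ W j :=
  Submodule.isOrtho_iff_inner_eq.2 (H.inner_eq_zero i j hij)

/-- The compression of `J` to `U` is block diagonal, because `J w` is orthogonal to the other
blocks. -/
theorem starProjection_eq (H : IsBlockDecomposition I J m U θ W) (i : Fin ((m + 1) / 2)) {w : V}
    (hw : w ∈ W i) : U.starProjection (J w) = (W i).starProjection (J w) := by
  apply Submodule.eq_starProjection_of_mem_orthogonal
  · exact H.le i ((W i).starProjection_apply_mem _)
  · rw [← H.iSup_eq, ← Submodule.iInf_orthogonal, Submodule.mem_iInf]
    intro j
    rcases eq_or_ne j i with rfl | hij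
    · exact (W j).sub_starProjection_mem_orthogonal _
    · rw [Submodule.mem_orthogonal]
      intro u hu
      rw [inner_sub_right, H.inner_J_eq_zero j i hij u hu w hw,
        H.inner_eq_zero j i hij u hu _ ((W i).starProjection_apply_mem _), sub_zero]

theorem norm_starProjection_sum_sq (H : IsBlockDecomposition I J m U θ W)
    {w : Fin ((m + 1) / 2) → V} (hw : ∀ i, w i ∈ W i) (s : Finset (Fin ((m + 1) / 2))) :
    ‖U.starProjection (J (∑ i ∈ s, w i))‖ ^ 2 = ∑ i ∈ s, Real.cos (θ i) ^ 2 * ‖w i‖ ^ 2 := by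
  rw [map_sum, map_sum, Finset.sum_congr rfl fun i _ => H.starProjection_eq i (hw i),
    norm_sum_sq_of_orthogonal s fun i j hij => H.inner_eq_zero i j hij _
      ((W i).starProjection_apply_mem _) _ ((W j).starProjection_apply_mem _)]
  exact Finset.sum_congr rfl fun i _ => by rw [(H.block i).norm_proj _ (hw i), mul_pow]

theorem norm_sum_sq (H : IsBlockDecomposition I J m U θ W)
    {w : Fin ((m + 1) / 2) → V} (hw : ∀ i, w i ∈ W i) (s : Finset (Fin ((m + 1) / 2))) :
    ‖∑ i ∈ s, w i‖ ^ 2 = ∑ i ∈ s, ‖w i‖ ^ 2 :=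
  norm_sum_sq_of_orthogonal s fun i j hij => H.inner_eq_zero i j hij _ (hw i) _ (hw j)

theorem finrank_biSup (H : IsBlockDecomposition I J m U θ W) (s : Finset (Fin ((m + 1) / 2)))
    (hs : ∀ i ∈ s, (i : ℕ) < m / 2) :
    Module.finrank ℝ (⨆ i ∈ s, W i : Submodule ℝ V) = 4 * s.card := by
  rw [finrank_biSup_of_orthogonal s H.isOrtho,
    Finset.sum_congr rfl fun i hi => by rw [H.finrank_eq, if_pos (hs i hi)]]
  rw [Finset.sum_const, smul_eq_mul, mul_comm]

theorem cos_nonneg (H : IsBlockDecomposition I J m U θ W) (i : Fin ((m + 1) / 2)) :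
    0 ≤ Real.cos (θ i) :=
  Real.cos_nonneg_of_mem_Icc ⟨by linarith [(H.mem_Icc i).1, Real.pi_pos], (H.mem_Icc i).2⟩

theorem cos_le_cos (H : IsBlockDecomposition I J m U θ W) (hθ : Monotone θ)
    {i j : Fin ((m + 1) / 2)} (hij : i ≤ j) : Real.cos (θ j) ≤ Real.cos (θ i) :=
  Real.cos_le_cos_of_nonneg_of_le_pi (H.mem_Icc i).1
    (by linarith [(H.mem_Icc j).2, Real.pi_pos]) (hθ hij)

/-- Courant–Fischer: if `θ' i < θ i`, the first `i + 1` blocks of `W'` meet the orthogonal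
complement in `U` of the first `i` blocks of `W`. A nonzero common vector would be stretched by at
least `cos (θ' i)` and by at most the smaller `cos (θ i)`. -/
theorem angle_le (H : IsBlockDecomposition I J m U θ W) (hθ : Monotone θ)
    {θ' : Fin ((m + 1) / 2) → ℝ} {W' : Fin ((m + 1) / 2) → Submodule ℝ V}
    (H' : IsBlockDecomposition I J m U θ' W') (hθ' : Monotone θ') (i : Fin ((m + 1) / 2)) :
    θ i ≤ θ' i := by
  by_contra! hlt
  -- The extra plane has angle `π/2` in both decompositions, so every block up to `i` has dimension
  -- 4.
  have hi : (i : ℕ) < m / 2 := by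
    by_contra! hi
    rw [H.last_eq i hi, H'.last_eq i hi] at hlt
    exact lt_irrefl _ hlt
  set F : Submodule ℝ V := ⨆ j ∈ Finset.Iic i, W' j with hF
  set L : Submodule ℝ V := ⨆ j ∈ Finset.Iio i, W j with hL
  have hFrank : Module.finrank ℝ F = 4 * (i + 1) := by
    rw [hF, H'.finrank_biSup _ fun j hj => lt_of_le_of_lt
      (Fin.le_def.1 (Finset.mem_Iic.1 hj)) hi, Fin.card_Iic]
  have hLrank : Module.finrank ℝ L = 4 * i := by
    rw [hL, H.finrank_biSup _ fun j hj => lt_trans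
      (Fin.lt_def.1 (Finset.mem_Iio.1 hj)) hi, Fin.card_Iio]
  have hFU : F ≤ U := iSup₂_le fun j _ => H'.le j
  have hLU : L ≤ U := iSup₂_le fun j _ => H.le j
  have hG := Submodule.finrank_add_inf_finrank_orthogonal hLU
  have hsum := Submodule.finrank_sup_add_finrank_inf_eq F (Lᗮ ⊓ U)
  have hsup : Module.finrank ℝ (F ⊔ (Lᗮ ⊓ U) : Submodule ℝ V) ≤ Module.finrank ℝ U :=
    Submodule.finrank_mono (sup_le hFU inf_le_right)
  -- The dimensions `4 (i + 1)` and `dim U - 4 i` exceed `dim U` by 4 in total.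
  have hpos : F ⊓ (Lᗮ ⊓ U) ≠ ⊥ := by
    intro h0
    rw [h0, finrank_bot] at hsum
    omega
  obtain ⟨x, ⟨hxF, hxL, hxU⟩, hx0⟩ := Submodule.exists_mem_ne_zero_of_ne_bot hpos
  have hcos : Real.cos (θ i) < Real.cos (θ' i) :=
    Real.cos_lt_cos_of_nonneg_of_le_pi (H'.mem_Icc i).1
      (by linarith [(H.mem_Icc i).2, Real.pi_pos]) hlt
  have hlow : Real.cos (θ' i) ^ 2 * ‖x‖ ^ 2 ≤ ‖U.starProjection (J x)‖ ^ 2 := by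
    obtain ⟨μ, rfl⟩ := (Submodule.mem_iSup_finset_iff_exists_sum _ _).1 hxF
    rw [H'.norm_starProjection_sum_sq (fun j => (μ j).2), H'.norm_sum_sq (fun j => (μ j).2),
      Finset.mul_sum]
    refine Finset.sum_le_sum fun j hj => mul_le_mul_of_nonneg_right ?_ (sq_nonneg _)
    exact pow_le_pow_left₀ (H'.cos_nonneg i) (H'.cos_le_cos hθ' (Finset.mem_Iic.1 hj)) 2
  have hup : ‖U.starProjection (J x)‖ ^ 2 ≤ Real.cos (θ i) ^ 2 * ‖x‖ ^ 2 := by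
    have hx : x ∈ ⨆ j ∈ Finset.univ, W j := by simpa [H.iSup_eq] using hxU
    obtain ⟨μ, rfl⟩ := (Submodule.mem_iSup_finset_iff_exists_sum _ _).1 hx
    rw [H.norm_starProjection_sum_sq (fun j => (μ j).2), H.norm_sum_sq (fun j => (μ j).2),
      Finset.mul_sum]
    refine Finset.sum_le_sum fun j _ => ?_
    -- Components below `i` vanish because `x ⟂ L`; for the others the cosine is at most `cos (θ
    -- i)`.
    rcases lt_or_ge j i with hj | hj
    · have hμL : (μ j : V) ∈ L :=
        Submodule.mem_iSup_of_mem j (Submodule.mem_iSup_of_mem (Finset.mem_Iio.2 hj) (μ j).2)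
      have h0 := Submodule.inner_right_of_mem_orthogonal hμL hxL
      rw [inner_sum, Finset.sum_eq_single_of_mem j (Finset.mem_univ j) fun l _ hl =>
        H.inner_eq_zero j l hl.symm _ (μ j).2 _ (μ l).2, real_inner_self_eq_norm_sq] at h0
      rw [h0, mul_zero, mul_zero]
    · exact mul_le_mul_of_nonneg_right
        (pow_le_pow_left₀ (H.cos_nonneg j) (H.cos_le_cos hθ hj) 2) (sq_nonneg _)
  have hxpos : 0 < ‖x‖ ^ 2 := by positivity
  have := le_of_mul_le_mul_right (hlow.trans hup) hxpos
  exact absurd ((sq_le_sq₀ (H'.cos_nonneg i) (H.cos_nonneg i)).1 this) (not_le.2 hcos)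

end IsBlockDecomposition

end Decompositions

/-! ### Complex lines for `I`. -/

section ComplexSpan

variable {V : Type*} [NormedAddCommGroup V] [InnerProductSpace ℝ V]

/-- The `I`-complex line generated by `x`. -/
def complexSpan (I : Module.End ℝ V) (x : V) : Submodule ℝ V := Submodule.span ℝ {x, I x}

theorem mem_complexSpan {I : Module.End ℝ V} {x v : V} :
    v ∈ complexSpan I x ↔ ∃ a b : ℝ, a • x + b • I x = v :=
  Submodule.mem_span_pair

theorem self_mem_complexSpan (I : Module.End ℝ V) (x : V) : x ∈ complexSpan I x :=
  mem_complexSpan.2 ⟨1, 0, by simp⟩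

theorem complexSpan_le {I : Module.End ℝ V} {U : Submodule ℝ V} (hU : ∀ x ∈ U, I x ∈ U) {x : V}
    (hx : x ∈ U) : complexSpan I x ≤ U := by
  rw [complexSpan, Submodule.span_le]
  rintro _ (rfl | rfl)
  · exact hx
  · exact hU _ hx

theorem complexSpan_zero (I : Module.End ℝ V) : complexSpan I 0 = ⊥ := by
  simp [complexSpan]

theorem map_complexSpan {I : Module.End ℝ V} {g : V →ₗ[ℝ] V} (hg : ∀ x, g (I x) = I (g x)) (x : V) :
    (complexSpan I x).map g = complexSpan I (g x) := by
  rw [complexSpan, Submodule.map_span, Set.image_pair, hg, complexSpan]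

variable {I J : Module.End ℝ V}

theorem IsAdaptedPair.complexSpan_apply_mem (h : IsAdaptedPair I J) {x v : V}
    (hv : v ∈ complexSpan I x) : I v ∈ complexSpan I x := by
  obtain ⟨a, b, rfl⟩ := mem_complexSpan.1 hv
  refine mem_complexSpan.2 ⟨-b, a, ?_⟩
  rw [map_add, map_smul, map_smul, h.II]
  module

theorem IsAdaptedPair.finrank_complexSpan (h : IsAdaptedPair I J) {x : V} (hx : x ≠ 0) :
    Module.finrank ℝ (complexSpan I x) = 2 := by
  have hli : LinearIndependent ℝ ![x, I x] := by
    rw [LinearIndependent.pair_iff]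
    intro a b hab
    have h1 : ⟪x, a • x + b • I x⟫ = 0 := by rw [hab, inner_zero_right]
    have h2 : ⟪I x, a • x + b • I x⟫ = 0 := by rw [hab, inner_zero_right]
    have hxx : ⟪x, x⟫ ≠ 0 := inner_self_ne_zero.2 hx
    rw [inner_add_right, real_inner_smul_right, real_inner_smul_right, h.inner_I_self] at h1
    rw [inner_add_right, real_inner_smul_right, real_inner_smul_right, h.inner_I_I,
      real_inner_comm, h.inner_I_self] at h2
    constructor
    · simpa [hxx, hx] using h1
    · simpa [hxx, hx] using h2
  have := finrank_span_eq_card hli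
  rwa [Matrix.range_cons, Matrix.range_cons, Matrix.range_empty, Set.union_empty,
    Set.singleton_union, Fintype.card_fin] at this

theorem IsAdaptedPair.complexSpan_isOrtho (h : IsAdaptedPair I J) {x y : V} (h1 : ⟪x, y⟫ = 0)
    (h2 : ⟪x, I y⟫ = 0) : complexSpan I x ⟂ complexSpan I y := by
  rw [Submodule.isOrtho_iff_inner_eq]
  intro u hu v hv
  obtain ⟨a, b, rfl⟩ := mem_complexSpan.1 hu
  obtain ⟨c, d, rfl⟩ := mem_complexSpan.1 hv
  simp only [inner_add_left, inner_add_right, real_inner_smul_left, real_inner_smul_right,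
    h.inner_I_I, h1, h2, h.skewI x y]
  ring

theorem IsAdaptedPair.finrank_complexSpan_sup [FiniteDimensional ℝ V] (h : IsAdaptedPair I J)
    {x y : V} (hx : x ≠ 0) (hy : y ≠ 0) (h1 : ⟪x, y⟫ = 0) (h2 : ⟪x, I y⟫ = 0) :
    Module.finrank ℝ (complexSpan I x ⊔ complexSpan I y : Submodule ℝ V) = 4 := by
  have := Submodule.finrank_sup_add_finrank_inf_eq (complexSpan I x) (complexSpan I y)
  rw [(h.complexSpan_isOrtho h1 h2).disjoint.eq_bot, finrank_bot, h.finrank_complexSpan hx,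
    h.finrank_complexSpan hy] at this
  simpa using this

theorem IsAdaptedPair.norm_combination_sq (h : IsAdaptedPair I J) {x y : V} (hx : ‖x‖ = 1)
    (hy : ‖y‖ = 1) (h1 : ⟪x, y⟫ = 0) (h2 : ⟪x, I y⟫ = 0) (a b c d : ℝ) :
    ‖(a • x + b • I x) + (c • y + d • I y)‖ ^ 2 = a ^ 2 + b ^ 2 + c ^ 2 + d ^ 2 := by
  have hort := (h.complexSpan_isOrtho h1 h2).inner_eq (mem_complexSpan.2 ⟨a, b, rfl⟩)
    (mem_complexSpan.2 ⟨c, d, rfl⟩)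
  have hn : ∀ (z : V) (a b : ℝ), ‖z‖ = 1 → ‖a • z + b • I z‖ ^ 2 = a ^ 2 + b ^ 2 := by
    intro z a b hz
    rw [norm_add_sq_real, norm_smul, norm_smul, real_inner_smul_left, real_inner_smul_right,
      h.inner_I_self, h.norm_I, hz, mul_pow, mul_pow, Real.norm_eq_abs, Real.norm_eq_abs, sq_abs,
      sq_abs]
    ring
  rw [norm_add_sq_real, hort, hn x a b hx, hn y c d hy]
  ring

end ComplexSpan

/-! ### Maximising vectors of the compression and their partners. -/

section Partner

variable {V : Type*} [NormedAddCommGroup V] [InnerProductSpace ℝ V] [FiniteDimensional ℝ V]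
  {I J : Module.End ℝ V} {U : Submodule ℝ V}

theorem inner_starProjection_of_mem {v u : V} (hu : u ∈ U) : ⟪U.starProjection v, u⟫ = ⟪v, u⟫ := by
  have := U.starProjection_inner_eq_zero v u hu
  rw [inner_sub_left] at this
  linarith

theorem starProjection_eq_of_le {W : Submodule ℝ V} (hWU : W ≤ U) {v : V}
    (hv : U.starProjection v ∈ W) : W.starProjection v = U.starProjection v :=
  Submodule.eq_starProjection_of_mem_orthogonal hv
    (Submodule.orthogonal_le hWU (U.sub_starProjection_mem_orthogonal v))

/-- The form `c² ‖v‖² - ‖A v‖²`, with `A` the compression of `J`, is nonnegative on `U` and vanishes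
at `x`, hence `x` lies in its kernel. -/
theorem inner_starProjection_of_maximal {c : ℝ}
    (hle : ∀ x ∈ U, ‖U.starProjection (J x)‖ ≤ c * ‖x‖) {x : V} (hx : x ∈ U)
    (heq : ‖U.starProjection (J x)‖ = c * ‖x‖) {v : V} (hv : v ∈ U) :
    ⟪U.starProjection (J x), U.starProjection (J v)⟫ = c ^ 2 * ⟪x, v⟫ := by
  -- The form evaluated at `x + t v`: with zero constant term, a nonpositive discriminant forces the
  -- linear coefficient to vanish.
  have key : ∀ t : ℝ, 0 ≤ (c ^ 2 * ‖v‖ ^ 2 - ‖U.starProjection (J v)‖ ^ 2) * (t * t) +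
      (2 * (c ^ 2 * ⟪x, v⟫ - ⟪U.starProjection (J x), U.starProjection (J v)⟫)) * t + 0 := by
    intro t
    have h1 := pow_le_pow_left₀ (norm_nonneg _) (hle _ (U.add_mem hx (U.smul_mem t hv))) 2
    rw [map_add, map_add, map_smul, map_smul, mul_pow, norm_add_sq_real, norm_add_sq_real, heq,
      norm_smul, norm_smul, real_inner_smul_right, real_inner_smul_right] at h1
    simp only [mul_pow, Real.norm_eq_abs, sq_abs] at h1
    linarith
  have hd := discrim_le_zero key
  rw [discrim] at hd
  have : (c ^ 2 * ⟪x, v⟫ - ⟪U.starProjection (J x), U.starProjection (J v)⟫) ^ 2 ≤ 0 := by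
    linarith
  have := pow_eq_zero_iff (two_ne_zero) |>.1 (le_antisymm this (sq_nonneg _))
  linarith

/-- With `A` the compression of `J`, skewness and maximality give `A (A x) = -c² x`, so for `c > 0`
the partner is `c⁻¹ A x`; it is orthogonal to `x` and `I x` because `J x` is. -/
theorem IsAdaptedPair.exists_partner (h : IsAdaptedPair I J) (hU : ∀ x ∈ U, I x ∈ U)
    (hdim : 4 ≤ Module.finrank ℝ U) {c : ℝ} (hc : 0 ≤ c)
    (hle : ∀ x ∈ U, ‖U.starProjection (J x)‖ ≤ c * ‖x‖) {x : V} (hx : x ∈ U) (hx1 : ‖x‖ = 1)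
    (heq : ‖U.starProjection (J x)‖ = c) :
    ∃ y ∈ U, ‖y‖ = 1 ∧ ⟪x, y⟫ = 0 ∧ ⟪x, I y⟫ = 0 ∧ U.starProjection (J x) = c • y ∧
      U.starProjection (J y) = -(c • x) := by
  have hx0 : x ≠ 0 := by
    rintro rfl
    simp at hx1
  -- If `c = 0` the compression vanishes on `U`, and any unit vector of `U` orthogonal to the
  -- complex line of `x` serves; dimension at least 4 leaves room for it.
  rcases hc.eq_or_lt with rfl | hc
  · have hrank := Submodule.finrank_add_inf_finrank_orthogonal (complexSpan_le hU hx)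
    rw [h.finrank_complexSpan hx0] at hrank
    have hne : (complexSpan I x)ᗮ ⊓ U ≠ ⊥ := by
      intro h0
      rw [h0, finrank_bot] at hrank
      omega
    obtain ⟨z, ⟨hzx, hzU⟩, hz0⟩ := Submodule.exists_mem_ne_zero_of_ne_bot hne
    have hzx' : ∀ u ∈ complexSpan I x, ⟪u, z⟫ = 0 := fun u hu =>
      Submodule.inner_right_of_mem_orthogonal hu hzx
    have hproj : ∀ v ∈ U, U.starProjection (J v) = 0 := fun v hv => by
      have := hle v hv
      rw [zero_mul] at this
      exact norm_le_zero_iff.1 this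
    have hxI := hzx' _ (h.complexSpan_apply_mem (self_mem_complexSpan I x))
    rw [h.skewI] at hxI
    refine ⟨‖z‖⁻¹ • z, U.smul_mem _ hzU, norm_smul_inv_norm hz0, ?_, ?_, ?_, ?_⟩
    · rw [real_inner_smul_right, hzx' _ (self_mem_complexSpan I x), mul_zero]
    · rw [map_smul, real_inner_smul_right, neg_eq_zero.1 hxI, mul_zero]
    · rw [hproj x hx, zero_smul]
    · rw [hproj _ (U.smul_mem _ hzU), zero_smul, neg_zero]
  · set Ax := U.starProjection (J x) with hAx
    have hAxU : Ax ∈ U := U.starProjection_apply_mem _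
    have hAA : U.starProjection (J Ax) = -(c ^ 2 • x) := by
      rw [← sub_eq_zero, ← inner_self_eq_zero (𝕜 := ℝ)]
      have hmem : U.starProjection (J Ax) - -(c ^ 2 • x) ∈ U :=
        U.sub_mem (U.starProjection_apply_mem _) (U.neg_mem (U.smul_mem _ hx))
      have hall : ∀ v ∈ U, ⟪U.starProjection (J Ax) - -(c ^ 2 • x), v⟫ = 0 := by
        intro v hv
        have h1 := inner_starProjection_of_maximal hle hx (by rw [← hAx, heq, hx1, mul_one]) hv
        rw [← hAx, real_inner_comm, inner_starProjection_of_mem hAxU] at h1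
        rw [sub_neg_eq_add, inner_add_left, inner_starProjection_of_mem hv, h.skewJ,
          real_inner_smul_left, real_inner_comm, h1]
        ring
      exact hall _ hmem
    refine ⟨c⁻¹ • Ax, U.smul_mem _ hAxU, ?_, ?_, ?_, ?_, ?_⟩
    · rw [norm_smul, heq, norm_inv, Real.norm_of_nonneg hc.le, inv_mul_cancel₀ hc.ne']
    · rw [real_inner_smul_right, real_inner_comm, hAx, inner_starProjection_of_mem hx,
        real_inner_comm, h.inner_J_self, mul_zero]
    · have h1 := h.skewI x Ax
      rw [real_inner_comm, hAx, inner_starProjection_of_mem (hU x hx), real_inner_comm, h.skewI,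
        h.inner_I_J_self] at h1
      rw [map_smul, real_inner_smul_right, hAx]
      rw [show ⟪x, I (U.starProjection (J x))⟫ = 0 by linarith, mul_zero]
    · rw [smul_inv_smul₀ hc.ne']
    · rw [map_smul, map_smul, hAA, smul_neg, smul_smul, pow_two, inv_mul_cancel_left₀ hc.ne']

/-- The compression is `I`-antilinear, which is where the signs come from; up to signs and order it
multiplies the coordinates by `c`. -/
theorem IsAdaptedPair.starProjection_combination (h : IsAdaptedPair I J) (hU : ∀ x ∈ U, I x ∈ U)
    {c : ℝ} {x y : V} (h1 : U.starProjection (J x) = c • y)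
    (h2 : U.starProjection (J y) = -(c • x)) (p q r s : ℝ) :
    U.starProjection (J ((p • x + q • I x) + (r • y + s • I y))) =
      ((-(c * r)) • x + (c * s) • I x) + ((c * p) • y + (-(c * q)) • I y) := by
  simp only [map_add, map_smul, h.JI, map_neg, h.starProjection_I hU, h1, h2]
  module

theorem IsAdaptedPair.starProjection_mem_complexSpan_sup (h : IsAdaptedPair I J)
    (hU : ∀ x ∈ U, I x ∈ U) {c : ℝ} {x y : V} (h1 : U.starProjection (J x) = c • y)
    (h2 : U.starProjection (J y) = -(c • x)) {w : V} (hw : w ∈ complexSpan I x ⊔ complexSpan I y) :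
    U.starProjection (J w) ∈ complexSpan I x ⊔ complexSpan I y := by
  obtain ⟨_, hu, _, hv, rfl⟩ := Submodule.mem_sup.1 hw
  obtain ⟨p, q, rfl⟩ := mem_complexSpan.1 hu
  obtain ⟨r, s, rfl⟩ := mem_complexSpan.1 hv
  rw [h.starProjection_combination hU h1 h2]
  exact Submodule.add_mem_sup (mem_complexSpan.2 ⟨_, _, rfl⟩) (mem_complexSpan.2 ⟨_, _, rfl⟩)

theorem IsAdaptedPair.isBlock_complexSpan_sup (h : IsAdaptedPair I J) (hU : ∀ x ∈ U, I x ∈ U)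
    {c : ℝ} (hc : 0 ≤ c) {x y : V} (hx : x ∈ U) (hy : y ∈ U) (hx1 : ‖x‖ = 1) (hy1 : ‖y‖ = 1)
    (hxy : ⟪x, y⟫ = 0) (hxIy : ⟪x, I y⟫ = 0) (h1 : U.starProjection (J x) = c • y)
    (h2 : U.starProjection (J y) = -(c • x)) :
    IsBlock I J c (complexSpan I x ⊔ complexSpan I y) := by
  constructor
  · intro w hw
    obtain ⟨_, hu, _, hv, rfl⟩ := Submodule.mem_sup.1 hw
    rw [map_add]
    exact Submodule.add_mem_sup (h.complexSpan_apply_mem hu) (h.complexSpan_apply_mem hv)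
  · intro w hw
    rw [starProjection_eq_of_le (sup_le (complexSpan_le hU hx) (complexSpan_le hU hy))
      (h.starProjection_mem_complexSpan_sup hU h1 h2 hw)]
    obtain ⟨_, hu, _, hv, rfl⟩ := Submodule.mem_sup.1 hw
    obtain ⟨p, q, rfl⟩ := mem_complexSpan.1 hu
    obtain ⟨r, s, rfl⟩ := mem_complexSpan.1 hv
    rw [h.starProjection_combination hU h1 h2, ← sq_eq_sq₀ (norm_nonneg _) (by positivity),
      mul_pow, h.norm_combination_sq hx1 hy1 hxy hxIy, h.norm_combination_sq hx1 hy1 hxy hxIy]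
    ring

end Partner

/-! ### Existence of block decompositions. -/

section Existence

variable {V : Type*} [NormedAddCommGroup V] [InnerProductSpace ℝ V] [FiniteDimensional ℝ V]
  {I J : Module.End ℝ V} {U : Submodule ℝ V}

theorem isBlock_bot (I J : Module.End ℝ V) (c : ℝ) : IsBlock I J c ⊥ := by
  constructor
  · rintro x rfl
    simp
  · rintro x rfl
    simp

/-- A block decomposition indexed by the natural numbers and eventually trivial. -/
structure IsBlockSequence (I J : Module.End ℝ V) (m : ℕ) (U : Submodule ℝ V)
    (θ : ℕ → ℝ) (W : ℕ → Submodule ℝ V) : Prop where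
  monotone : Monotone θ
  block : ∀ i, IsBlock I J (Real.cos (θ i)) (W i)
  mem_Icc : ∀ i, θ i ∈ Set.Icc 0 (Real.pi / 2)
  finrank_eq : ∀ i, Module.finrank ℝ (W i) = if i < m / 2 then 4 else if i < (m + 1) / 2 then 2 else 0
  last_eq : ∀ i, m / 2 ≤ i → θ i = Real.pi / 2
  inner_eq_zero : ∀ i j, i ≠ j → ∀ x ∈ W i, ∀ y ∈ W j, ⟪x, y⟫ = 0
  inner_J_eq_zero : ∀ i j, i ≠ j → ∀ x ∈ W i, ∀ y ∈ W j, ⟪x, J y⟫ = 0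
  iSup_eq : ⨆ i, W i = U

theorem IsBlockSequence.isBlockDecomposition {m : ℕ} {θ : ℕ → ℝ} {W : ℕ → Submodule ℝ V}
    (H : IsBlockSequence I J m U θ W) :
    IsBlockDecomposition I J m U (fun i => θ i) (fun i => W i) where
  block i := H.block i
  mem_Icc i := H.mem_Icc i
  finrank_eq i := by rw [H.finrank_eq, if_pos i.2]
  last_eq i := H.last_eq i
  inner_eq_zero i j hij := H.inner_eq_zero i j (fun h => hij (Fin.ext h))
  inner_J_eq_zero i j hij := H.inner_J_eq_zero i j (fun h => hij (Fin.ext h))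
  iSup_eq := by
    rw [← H.iSup_eq]
    apply le_antisymm
    · exact iSup_le fun i => le_iSup W i
    · refine iSup_le fun i => ?_
      by_cases hi : i < (m + 1) / 2
      · exact le_iSup (fun i : Fin ((m + 1) / 2) => W i) ⟨i, hi⟩
      · have := H.finrank_eq i
        rw [if_neg (by omega), if_neg hi, Submodule.finrank_eq_zero] at this
        rw [this]
        exact bot_le

/-- Indexing by `ℕ` makes prepending a block a mere shift, with no transport between index types
depending on `m`. -/
theorem IsBlockSequence.cons (h : IsAdaptedPair I J) {m : ℕ} {θ : ℕ → ℝ} {W : ℕ → Submodule ℝ V}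
    (H : IsBlockSequence I J m U θ W) {W₀ : Submodule ℝ V} {θ₀ : ℝ}
    (hb : IsBlock I J (Real.cos θ₀) W₀) (hθ₀ : θ₀ ∈ Set.Icc 0 (Real.pi / 2))
    (hdim : Module.finrank ℝ W₀ = 4) (hle : θ₀ ≤ θ 0) (hort : ∀ x ∈ W₀, ∀ y ∈ U, ⟪x, y⟫ = 0)
    (hortJ : ∀ x ∈ W₀, ∀ y ∈ U, ⟪x, J y⟫ = 0) :
    IsBlockSequence I J (m + 2) (W₀ ⊔ U) (fun i => i.casesOn θ₀ θ) (fun i => i.casesOn W₀ W) := by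
  have hWU : ∀ i, W i ≤ U := fun i => H.iSup_eq ▸ le_iSup W i
  have hm : (m + 2) / 2 = m / 2 + 1 := by omega
  have hm' : (m + 2 + 1) / 2 = (m + 1) / 2 + 1 := by omega
  refine ⟨monotone_nat_of_le_succ ?_, ?_, ?_, ?_, ?_, ?_, ?_, ?_⟩
  · rintro (_ | i)
    · exact hle
    · exact H.monotone (Nat.le_succ i)
  · rintro (_ | i)
    · exact hb
    · exact H.block i
  · rintro (_ | i)
    · exact hθ₀
    · exact H.mem_Icc i
  · rintro (_ | i)
    · simp [hm, hdim]
    · simp [hm, hm', H.finrank_eq]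
  · rintro (_ | i) hi
    · omega
    · exact H.last_eq i (by omega)
  · rintro (_ | i) (_ | j) hij x hx y hy
    · exact absurd rfl hij
    · exact hort x hx y (hWU j hy)
    · rw [real_inner_comm]
      exact hort y hy x (hWU i hx)
    · exact H.inner_eq_zero i j (by omega) x hx y hy
  · rintro (_ | i) (_ | j) hij x hx y hy
    · exact absurd rfl hij
    · exact hortJ x hx y (hWU j hy)
    · have := hortJ y hy x (hWU i hx)
      rw [real_inner_comm, h.skewJ] at this
      linarith
    · exact H.inner_J_eq_zero i j (by omega) x hx y hy
  · rw [← sup_iSup_nat_succ, ← H.iSup_eq]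
    rfl

/-- The unit sphere of `U` is compact; homogeneity extends the bound to all of `U`. -/
theorem exists_maximal (J : Module.End ℝ V) (hU : U ≠ ⊥) :
    ∃ x ∈ U, ‖x‖ = 1 ∧ ∀ v ∈ U, ‖U.starProjection (J v)‖ ≤ ‖U.starProjection (J x)‖ * ‖v‖ := by
  obtain ⟨z, hzU, hz0⟩ := Submodule.exists_mem_ne_zero_of_ne_bot hU
  have hcomp : IsCompact (Metric.sphere (0 : V) 1 ∩ U) :=
    (isCompact_sphere (0 : V) 1).inter_right U.closed_of_finiteDimensional
  have hunit : ∀ z ∈ U, z ≠ 0 → ‖z‖⁻¹ • z ∈ Metric.sphere (0 : V) 1 ∩ U := fun z hzU hz0 =>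
    ⟨by rw [mem_sphere_zero_iff_norm]; exact norm_smul_inv_norm hz0, U.smul_mem _ hzU⟩
  have hcont : Continuous fun v => ‖U.starProjection (J v)‖ :=
    (U.starProjection.continuous.comp (LinearMap.continuous_of_finiteDimensional J)).norm
  obtain ⟨x, ⟨hx1, hxU⟩, hmax⟩ := hcomp.exists_isMaxOn ⟨_, hunit z hzU hz0⟩ hcont.continuousOn
  refine ⟨x, hxU, mem_sphere_zero_iff_norm.1 hx1, fun v hv => ?_⟩
  rcases eq_or_ne v 0 with rfl | hv0
  · simp
  have := hmax (hunit v hv hv0)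
  simp only [Set.mem_ofPred_eq, map_smul, norm_smul, norm_inv, norm_norm] at this
  rwa [inv_mul_le_iff₀ (norm_pos_iff.2 hv0), mul_comm] at this

/-- Such a plane is spanned by `x` and `I x`, and `J x` is orthogonal to both. -/
theorem IsAdaptedPair.isBlock_zero_of_finrank_eq_two (h : IsAdaptedPair I J)
    (hU : ∀ x ∈ U, I x ∈ U) (hdim : Module.finrank ℝ U = 2) : IsBlock I J 0 U := by
  refine ⟨hU, fun x hx => ?_⟩
  rw [zero_mul, norm_eq_zero, Submodule.starProjection_apply_eq_zero_iff]
  rcases eq_or_ne x 0 with rfl | hx0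
  · simp
  have hspan : complexSpan I x = U :=
    Submodule.eq_of_le_of_finrank_eq (complexSpan_le hU hx) (by rw [h.finrank_complexSpan hx0, hdim])
  rw [← hspan, Submodule.mem_orthogonal]
  intro u hu
  obtain ⟨a, b, rfl⟩ := mem_complexSpan.1 hu
  rw [inner_add_left, real_inner_smul_left, real_inner_smul_left, h.inner_J_self, h.skewI,
    h.inner_I_J_self]
  ring

theorem IsAdaptedPair.exists_isBlockSequence (h : IsAdaptedPair I J) (m : ℕ)
    (hU : ∀ x ∈ U, I x ∈ U) (hdim : Module.finrank ℝ U = 2 * m) :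
    ∃ θ W, IsBlockSequence I J m U θ W := by
  induction m using Nat.strong_induction_on generalizing U with
  | _ m ih =>
  have hpi := Real.pi_pos
  match m with
  | 0 =>
    rw [mul_zero, Submodule.finrank_eq_zero] at hdim
    subst hdim
    -- The trivial trailing blocks get the largest admissible angle, which keeps the sequence
    -- monotone.
    refine ⟨fun _ => Real.pi / 2, fun _ => ⊥, monotone_const, fun _ => isBlock_bot I J _,
      fun _ => ⟨by positivity, le_rfl⟩, fun i => by simp, fun _ _ => rfl, ?_, ?_, by simp⟩
    · rintro i j - x rfl y rfl
      simp
    · rintro i j - x rfl y rfl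
      simp
  | 1 =>
    refine ⟨fun _ => Real.pi / 2, fun i => i.casesOn U fun _ => ⊥, monotone_const, ?_,
      fun _ => ⟨by positivity, le_rfl⟩, ?_, fun _ _ => rfl, ?_, ?_, ?_⟩
    · rintro (_ | i)
      · rw [Real.cos_pi_div_two]
        exact h.isBlock_zero_of_finrank_eq_two hU hdim
      · exact isBlock_bot I J _
    · rintro (_ | i)
      · simpa using hdim
      · simp
    · rintro (_ | i) (_ | j) hij x hx y hy
      · exact absurd rfl hij
      all_goals first
        | rw [(Submodule.mem_bot ℝ).1 hy, inner_zero_right]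
        | rw [(Submodule.mem_bot ℝ).1 hx, inner_zero_left]
    · rintro (_ | i) (_ | j) hij x hx y hy
      · exact absurd rfl hij
      all_goals first
        | rw [(Submodule.mem_bot ℝ).1 hy, map_zero, inner_zero_right]
        | rw [(Submodule.mem_bot ℝ).1 hx, inner_zero_left]
    · rw [← sup_iSup_nat_succ]
      simp
  | m + 2 =>
    have hU0 : U ≠ ⊥ := by
      rintro rfl
      rw [finrank_bot] at hdim
      omega
    obtain ⟨x, hx, hx1, hle⟩ := exists_maximal J hU0
    set c := ‖U.starProjection (J x)‖ with hc
    have hc0 : 0 ≤ c := norm_nonneg _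
    have hc1 : c ≤ 1 := by
      have := U.norm_starProjection_apply_le (J x)
      rwa [h.norm_J, hx1] at this
    obtain ⟨y, hy, hy1, hxy, hxIy, hJx, hJy⟩ :=
      h.exists_partner hU (by omega) hc0 hle hx hx1 hc.symm
    have hx0 : x ≠ 0 := norm_ne_zero_iff.1 (by rw [hx1]; exact one_ne_zero)
    have hy0 : y ≠ 0 := norm_ne_zero_iff.1 (by rw [hy1]; exact one_ne_zero)
    have hb := h.isBlock_complexSpan_sup hU hc0 hx hy hx1 hy1 hxy hxIy hJx hJy
    have hdimW := h.finrank_complexSpan_sup hx0 hy0 hxy hxIy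
    have hmem := fun w hw => h.starProjection_mem_complexSpan_sup hU hJx hJy (w := w) hw
    have hWU : complexSpan I x ⊔ complexSpan I y ≤ U :=
      sup_le (complexSpan_le hU hx) (complexSpan_le hU hy)
    set W₀ := complexSpan I x ⊔ complexSpan I y with hW₀
    have hcos : Real.cos (Real.arccos c) = c := Real.cos_arccos (by linarith) hc1
    have hrank := Submodule.finrank_add_inf_finrank_orthogonal hWU
    have hort : ∀ w ∈ W₀, ∀ u ∈ W₀ᗮ ⊓ U, ⟪w, u⟫ = 0 := fun w hw u hu =>
      Submodule.inner_right_of_mem_orthogonal hw hu.1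
    -- The projection of `J w` on `U` stays in `W₀`, so ordinary orthogonality to `W₀` inside `U` is
    -- already Hermitian.
    have hortJ : ∀ w ∈ W₀, ∀ u ∈ W₀ᗮ ⊓ U, ⟪w, J u⟫ = 0 := fun w hw u hu => by
      have h1 := hort _ (hmem w hw) u hu
      rw [inner_starProjection_of_mem hu.2, h.skewJ] at h1
      linarith
    obtain ⟨θ, W, H⟩ := ih m (by omega) (U := W₀ᗮ ⊓ U) (fun u hu => ⟨by
        rw [SetLike.mem_coe, Submodule.mem_orthogonal]
        intro w hw
        have := hort _ (hb.apply_mem w hw) u hu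
        rw [h.skewI] at this
        linarith, hU u hu.2⟩) (by omega)
    -- Projecting on the smaller `W 0` shortens vectors, so maximality of `c` on `U` gives `cos (θ
    -- 0) ≤ c`.
    have hθ : Real.arccos c ≤ θ 0 := by
      rcases Nat.eq_zero_or_pos (m / 2) with hm | hm
      · rw [H.last_eq 0 (by omega)]
        exact Real.arccos_le_pi_div_two.2 hc0
      have hW0 : W 0 ≠ ⊥ := by
        intro h0
        have := H.finrank_eq 0
        rw [h0, finrank_bot, if_pos hm] at this
        omega
      obtain ⟨w, hw, hw0⟩ := Submodule.exists_mem_ne_zero_of_ne_bot hW0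
      have hWU' : W 0 ≤ U := (H.iSup_eq ▸ le_iSup W 0 : W 0 ≤ W₀ᗮ ⊓ U).trans inf_le_right
      have h1 := (H.block 0).norm_proj w hw
      have h2 : ‖(W 0).starProjection (J w)‖ ≤ ‖U.starProjection (J w)‖ := by
        rw [← Submodule.starProjection_comp_starProjection_of_le hWU', ContinuousLinearMap.comp_apply]
        exact (W 0).norm_starProjection_apply_le _
      have h3 : Real.cos (θ 0) ≤ c :=
        le_of_mul_le_mul_right (h1 ▸ h2.trans (hle w (hWU' hw))) (norm_pos_iff.2 hw0)
      rw [← Real.arccos_cos (H.mem_Icc 0).1 (by linarith [(H.mem_Icc 0).2])]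
      exact Real.arccos_le_arccos h3
    have hfin := H.cons h (W₀ := W₀) (θ₀ := Real.arccos c) (by rwa [hcos])
      ⟨Real.arccos_nonneg _, Real.arccos_le_pi_div_two.2 hc0⟩ hdimW hθ hort hortJ
    rw [Submodule.sup_orthogonal_inf_of_hasOrthogonalProjection hWU] at hfin
    exact ⟨_, _, hfin⟩

theorem IsAdaptedTo.existsUnique_isMultipleangle {Q : Submodule ℝ (Module.End ℝ V)}
    (h : IsAdaptedTo Q I J) {m : ℕ} (hU : U ∈ pureComplexGr Q I m) :
    ∃! θ : Fin ((m + 1) / 2) → ℝ, IsMultipleangle Q I m U θ := by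
  obtain ⟨hdim, hpure, hc⟩ := hU
  obtain ⟨θ, W, H⟩ := h.exists_isBlockSequence m ((isComplex_iff h.II).1 hc) hdim
  refine ⟨fun i => θ i, h.isMultipleangle_iff.2 ⟨fun i j hij => H.monotone hij, _,
    H.isBlockDecomposition, fun i _ Z hZ hQ => hpure Z (hZ.trans (H.isBlockDecomposition.le i)) hQ⟩,
    fun θ' hθ' => ?_⟩
  obtain ⟨hmono', W', H', -⟩ := h.isMultipleangle_iff.1 hθ'
  have hmono : Monotone fun i : Fin ((m + 1) / 2) => θ i := fun i j hij => H.monotone hij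
  funext i
  exact le_antisymm (H'.angle_le hmono' H.isBlockDecomposition hmono i)
    (H.isBlockDecomposition.angle_le hmono H' hmono' i)

end Existence

/-! ### Quaternionic orthonormal frames and isometries between them. -/

section Frames

variable {V : Type*} [NormedAddCommGroup V] [InnerProductSpace ℝ V] {I J : Module.End ℝ V}

/-- `x` and `y` are orthogonal for the quaternionic Hermitian product. -/
structure QuatPerp (I J : Module.End ℝ V) (x y : V) : Prop where
  inner : ⟪x, y⟫ = 0
  inner_I : ⟪x, I y⟫ = 0
  inner_J : ⟪x, J y⟫ = 0
  inner_I_J : ⟪x, I (J y)⟫ = 0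

/-- The quaternionic line generated by `x` has the orthogonal basis `x, I x, J x, I J x`. -/
def quatFrame (I J : Module.End ℝ V) (x : V) : Fin 4 → V := ![x, I x, J x, I (J x)]

theorem IsAdaptedPair.quatPerp_of_inner_quatFrame (h : IsAdaptedPair I J) {x y : V}
    (H : ∀ a, ⟪quatFrame I J x a, y⟫ = 0) : QuatPerp I J x y := by
  have h0 : ⟪x, y⟫ = 0 := H 0
  have h1 : ⟪I x, y⟫ = 0 := H 1
  have h2 : ⟪J x, y⟫ = 0 := H 2
  have h3 : ⟪I (J x), y⟫ = 0 := H 3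
  refine ⟨h0, ?_, ?_, ?_⟩
  · rw [h.skewI] at h1
    linarith
  · rw [h.skewJ] at h2
    linarith
  · rw [h.skewI, h.skewJ, h.JI, inner_neg_right] at h3
    linarith

theorem IsAdaptedPair.quatPerp_symm (h : IsAdaptedPair I J) {x y : V} (H : QuatPerp I J x y) :
    QuatPerp I J y x := by
  obtain ⟨h0, h1, h2, h3⟩ := H
  refine ⟨?_, ?_, ?_, ?_⟩
  · rw [real_inner_comm, h0]
  · rw [real_inner_comm, h.skewI, h1, neg_zero]
  · rw [real_inner_comm, h.skewJ, h2, neg_zero]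
  · rw [real_inner_comm, h.skewI, h.skewJ, h.JI, inner_neg_right, h3]
    simp

theorem IsAdaptedPair.inner_quatFrame (h : IsAdaptedPair I J) {x y : V} (H : QuatPerp I J x y)
    (a b : Fin 4) : ⟪quatFrame I J x a, quatFrame I J y b⟫ = 0 := by
  obtain ⟨h0, h1, h2, h3⟩ := H
  fin_cases a <;> fin_cases b <;>
    simp [quatFrame, h.skewI, h.skewJ, h.II, h.JJ, h.JI, h0, h1, h2, h3]

theorem IsAdaptedPair.orthonormal_quatFrame (h : IsAdaptedPair I J) {x : V} (hx : ‖x‖ = 1) :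
    Orthonormal ℝ (quatFrame I J x) := by
  constructor
  · intro a
    fin_cases a <;> simp [quatFrame, h.norm_I, h.norm_J, hx]
  · intro a b hab
    fin_cases a <;> fin_cases b <;>
      first
      | exact absurd rfl hab
      | simp [quatFrame, h.skewI, h.skewJ, h.II, h.JJ, h.JI, h.inner_I_self, h.inner_J_self,
          h.inner_I_J_self]

/-- A family of vectors which is orthonormal for the quaternionic Hermitian product. -/
structure IsQuatOrthonormal (I J : Module.End ℝ V) {ι : Type*} (v : ι → V) : Prop where
  norm_eq : ∀ i, ‖v i‖ = 1
  perp : ∀ i j, i ≠ j → QuatPerp I J (v i) (v j)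

theorem IsQuatOrthonormal.orthonormal (h : IsAdaptedPair I J) {ι : Type*} {v : ι → V}
    (hv : IsQuatOrthonormal I J v) :
    Orthonormal ℝ fun p : ι × Fin 4 => quatFrame I J (v p.1) p.2 := by
  constructor
  · exact fun p => (h.orthonormal_quatFrame (hv.norm_eq p.1)).1 p.2
  · rintro ⟨i, a⟩ ⟨j, b⟩ hne
    rcases eq_or_ne i j with rfl | hij
    · exact (h.orthonormal_quatFrame (hv.norm_eq i)).2 fun hab => hne (Prod.ext rfl hab)
    · exact h.inner_quatFrame (hv.perp i j hij) a b

theorem IsAdaptedPair.quatPerp_of_mem_sup_map (h : IsAdaptedPair I J) {U W : Submodule ℝ V}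
    (hW : ∀ x ∈ W, I x ∈ W) (h1 : ∀ x ∈ U, ∀ y ∈ W, ⟪x, y⟫ = 0)
    (h2 : ∀ x ∈ U, ∀ y ∈ W, ⟪x, J y⟫ = 0) {x y : V}
    (hx : x ∈ U ⊔ U.map J) (hy : y ∈ W ⊔ W.map J) : QuatPerp I J x y :=
  ⟨h.inner_eq_zero_of_mem_sup_map h1 h2 hx hy,
    h.inner_eq_zero_of_mem_sup_map h1 h2 hx (h.I_mem_sup_map hW hy),
    h.inner_eq_zero_of_mem_sup_map h1 h2 hx (h.J_mem_sup_map hy),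
    h.inner_eq_zero_of_mem_sup_map h1 h2 hx (h.I_mem_sup_map hW (h.J_mem_sup_map hy))⟩

/-- A quaternionic subspace of the image is carried back by the inverse of `g` to a quaternionic
subspace of `W`. -/
theorem IsPure.map {Q : Submodule ℝ (Module.End ℝ V)} {W : Submodule ℝ V} (hp : IsPure Q W) {g : V ≃ₗᵢ[ℝ] V} (hg : g ∈ Sp Q) :
    IsPure Q (W.map (g.toLinearEquiv : V →ₗ[ℝ] V)) := by
  intro Z hZ hZQ
  have hcomap : Z.map (g.symm.toLinearEquiv : V →ₗ[ℝ] V) = ⊥ := by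
    apply hp
    · rintro _ ⟨z, hz, rfl⟩
      obtain ⟨w, hw, rfl⟩ := hZ hz
      change g.symm (g w) ∈ W
      rwa [g.symm_apply_apply]
    · intro A hA
      have hcomm : A ∘ₗ (g.symm.toLinearEquiv : V →ₗ[ℝ] V) =
          (g.symm.toLinearEquiv : V →ₗ[ℝ] V) ∘ₗ A :=
        LinearMap.ext fun x => ((Sp Q).inv_mem hg A hA.1 x).symm
      rw [← Submodule.map_comp, hcomm, Submodule.map_comp, hZQ A hA]
  rwa [Submodule.map_eq_bot_iff] at hcomap

variable [FiniteDimensional ℝ V]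

/-- The real span of the frames has dimension `4 * card ι`; any unit vector orthogonal to it is
quaternionically orthogonal to the family. -/
theorem IsQuatOrthonormal.exists_option (h : IsAdaptedPair I J) {ι : Type*} [Fintype ι]
    {v : ι → V} (hv : IsQuatOrthonormal I J v)
    (hcard : 4 * Fintype.card ι < Module.finrank ℝ V) :
    ∃ u, IsQuatOrthonormal I J fun o : Option ι => o.elim u v := by
  have hli := (hv.orthonormal h).linearIndependent
  set S := Submodule.span ℝ (Set.range fun p : ι × Fin 4 => quatFrame I J (v p.1) p.2) with hS
  have hrank : Module.finrank ℝ S = 4 * Fintype.card ι := by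
    rw [hS, finrank_span_eq_card hli, Fintype.card_prod, Fintype.card_fin, mul_comm]
  have hne : Sᗮ ≠ ⊥ := by
    intro h0
    have := S.finrank_add_finrank_orthogonal
    rw [h0, finrank_bot] at this
    omega
  obtain ⟨z, hz, hz0⟩ := Submodule.exists_mem_ne_zero_of_ne_bot hne
  have hp : ∀ i, QuatPerp I J (v i) (‖z‖⁻¹ • z) := fun i =>
    h.quatPerp_of_inner_quatFrame fun a => Submodule.inner_right_of_mem_orthogonal
      (hS ▸ Submodule.subset_span (Set.mem_range_self (i, a))) (Sᗮ.smul_mem _ hz)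
  refine ⟨‖z‖⁻¹ • z, ?_, ?_⟩
  · rintro (_ | i)
    · exact norm_smul_inv_norm hz0
    · exact hv.norm_eq i
  · rintro (_ | i) (_ | j) hij
    · exact absurd rfl hij
    · exact h.quatPerp_symm (hp j)
    · exact hp i
    · exact hv.perp i j fun hij' => hij (by rw [hij'])

/-- The isometry matching the two real orthonormal bases commutes with `I` and `J`, since these act
on every `quatFrame` by the same signed permutation. -/
theorem IsQuatOrthonormal.exists_isometry_of_card_eq (h : IsAdaptedPair I J) {ι : Type*} [Fintype ι]
    {v v' : ι → V} (hv : IsQuatOrthonormal I J v) (hv' : IsQuatOrthonormal I J v')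
    (hcard : Module.finrank ℝ V = 4 * Fintype.card ι) :
    ∃ g : V ≃ₗᵢ[ℝ] V, (∀ x, g (I x) = I (g x)) ∧ (∀ x, g (J x) = J (g x)) ∧ ∀ i, g (v i) = v' i := by
  have hcard' : Fintype.card (ι × Fin 4) = Module.finrank ℝ V := by
    rw [hcard, Fintype.card_prod, Fintype.card_fin, mul_comm]
  have hb := hv.orthonormal h
  have hb' := hv'.orthonormal h
  let b := OrthonormalBasis.mk hb (hb.linearIndependent.span_eq_top_of_card_eq_finrank' hcard').ge
  let b' := OrthonormalBasis.mk hb' (hb'.linearIndependent.span_eq_top_of_card_eq_finrank' hcard').ge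
  let g := b.equiv b' (Equiv.refl _)
  have hbv : ∀ p, b p = quatFrame I J (v p.1) p.2 := fun p => congrFun (OrthonormalBasis.coe_mk _ _) p
  have hg : ∀ i a, g (quatFrame I J (v i) a) = quatFrame I J (v' i) a := by
    intro i a
    have := b.equiv_apply_basis b' (Equiv.refl _) (i, a)
    rw [hbv] at this
    exact this.trans (congrFun (OrthonormalBasis.coe_mk _ _) (i, a))
  have g0 : ∀ i, g (v i) = v' i := fun i => hg i 0
  have g1 : ∀ i, g (I (v i)) = I (v' i) := fun i => hg i 1
  have g2 : ∀ i, g (J (v i)) = J (v' i) := fun i => hg i 2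
  have g3 : ∀ i, g (I (J (v i))) = I (J (v' i)) := fun i => hg i 3
  have hext : ∀ A : Module.End ℝ V,
      (∀ i a, g (A (quatFrame I J (v i) a)) = A (g (quatFrame I J (v i) a))) →
        ∀ x, g (A x) = A (g x) := by
    intro A hA
    have : (g.toLinearEquiv : V →ₗ[ℝ] V) ∘ₗ A = A ∘ₗ (g.toLinearEquiv : V →ₗ[ℝ] V) := by
      refine b.toBasis.ext fun p => ?_
      rw [OrthonormalBasis.coe_toBasis, hbv]
      exact hA p.1 p.2
    exact LinearMap.congr_fun this
  refine ⟨g, hext I fun i a => ?_, hext J fun i a => ?_, g0⟩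
  · fin_cases a <;> simp [quatFrame, h.II, g0, g1, g2, g3]
  · fin_cases a <;> simp [quatFrame, h.JI, h.JJ, g0, g1, g2, g3]

theorem IsQuatOrthonormal.exists_isometry (h : IsAdaptedPair I J) (k : ℕ) {ι : Type*} [Fintype ι]
    {v v' : ι → V} (hv : IsQuatOrthonormal I J v) (hv' : IsQuatOrthonormal I J v')
    (hcard : Module.finrank ℝ V = 4 * (Fintype.card ι + k)) :
    ∃ g : V ≃ₗᵢ[ℝ] V, (∀ x, g (I x) = I (g x)) ∧ (∀ x, g (J x) = J (g x)) ∧ ∀ i, g (v i) = v' i := by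
  induction k generalizing ι with
  | zero => exact hv.exists_isometry_of_card_eq h hv' hcard
  | succ k ih =>
    -- `k` counts the missing vectors; both families grow together, so the longer ones still
    -- correspond.
    obtain ⟨u, hu⟩ := hv.exists_option h (by omega)
    obtain ⟨u', hu'⟩ := hv'.exists_option h (by omega)
    obtain ⟨g, hgI, hgJ, hg⟩ := ih hu hu' (by rw [Fintype.card_option]; omega)
    exact ⟨g, hgI, hgJ, fun i => hg (some i)⟩

theorem IsQuatOrthonormal.four_mul_card_le (h : IsAdaptedPair I J) {ι : Type*} [Fintype ι]
    {v : ι → V} (hv : IsQuatOrthonormal I J v) : 4 * Fintype.card ι ≤ Module.finrank ℝ V := by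
  have := (hv.orthonormal h).linearIndependent.fintype_card_le_finrank
  rwa [Fintype.card_prod, Fintype.card_fin, mul_comm] at this

end Frames

/-! ### Normal form of blocks and transitivity. -/

section Transitivity

variable {V : Type*} [NormedAddCommGroup V] [InnerProductSpace ℝ V] [FiniteDimensional ℝ V]
  {I J : Module.End ℝ V}

theorem IsAdaptedPair.exists_generator (h : IsAdaptedPair I J) {W : Submodule ℝ V}
    (hW : ∀ x ∈ W, I x ∈ W) (hdim : Module.finrank ℝ W = 2) :
    ∃ x ∈ W, ‖x‖ = 1 ∧ W = complexSpan I x := by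
  have hne : W ≠ ⊥ := by
    rintro rfl
    simp at hdim
  obtain ⟨x, hx, hx1, -⟩ := exists_maximal J hne
  have hx0 : x ≠ 0 := norm_ne_zero_iff.1 (by rw [hx1]; exact one_ne_zero)
  exact ⟨x, hx, hx1, (Submodule.eq_of_le_of_finrank_eq (complexSpan_le hW hx)
    (by rw [h.finrank_complexSpan hx0, hdim])).symm⟩

/-- At angle `0` projecting `J x` on `W` preserves its norm, so `J W ⊆ W` and `W` is quaternionic,
against purity. -/
theorem IsAdaptedTo.sin_pos_of_isPure {Q : Submodule ℝ (Module.End ℝ V)} (h : IsAdaptedTo Q I J)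
    {W : Submodule ℝ V} {θ : ℝ} (hθ : θ ∈ Set.Icc 0 (Real.pi / 2))
    (hb : IsBlock I J (Real.cos θ) W) (hp : IsPure Q W) (hne : W ≠ ⊥) : 0 < Real.sin θ := by
  rcases hθ.1.eq_or_lt with rfl | hpos
  · refine absurd (hp W le_rfl (h.isQuaternionic hb.apply_mem fun x hx => ?_)) hne
    rw [Submodule.mem_iff_norm_starProjection, hb.norm_proj x hx, Real.cos_zero, one_mul, h.norm_J]
  · exact Real.sin_pos_of_pos_of_lt_pi hpos (by linarith [hθ.2, Real.pi_pos])

/-- `z` is the normalised part of the partner `y` orthogonal to `J x`: `y = cos θ • J x + sin θ •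
z`, where purity allows division by `sin θ`. -/
theorem IsAdaptedTo.exists_frame {Q : Submodule ℝ (Module.End ℝ V)} (h : IsAdaptedTo Q I J)
    {W : Submodule ℝ V} {θ : ℝ} (hθ : θ ∈ Set.Icc 0 (Real.pi / 2))
    (hb : IsBlock I J (Real.cos θ) W) (hp : IsPure Q W) (hdim : Module.finrank ℝ W = 4) :
    ∃ x ∈ W, ∃ z ∈ W ⊔ W.map J, ‖x‖ = 1 ∧ ‖z‖ = 1 ∧ QuatPerp I J x z ∧
      W = complexSpan I x ⊔ complexSpan I (Real.cos θ • J x + Real.sin θ • z) := by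
  have hne : W ≠ ⊥ := by
    rintro rfl
    simp at hdim
  have hs := h.sin_pos_of_isPure hθ hb hp hne
  have hc0 : 0 ≤ Real.cos θ :=
    Real.cos_nonneg_of_mem_Icc ⟨by linarith [hθ.1, Real.pi_pos], hθ.2⟩
  have hsc := Real.sin_sq_add_cos_sq θ
  set c := Real.cos θ
  set s := Real.sin θ
  obtain ⟨x, hx, hx1, -⟩ := exists_maximal J hne
  obtain ⟨y, hy, hy1, hxy, hxIy, hJx, -⟩ := h.exists_partner hb.apply_mem hdim.ge hc0
    (fun v hv => (hb.norm_proj v hv).le) hx hx1 (by rw [hb.norm_proj x hx, hx1, mul_one])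
  have hx0 : x ≠ 0 := norm_ne_zero_iff.1 (by rw [hx1]; exact one_ne_zero)
  have hy0 : y ≠ 0 := norm_ne_zero_iff.1 (by rw [hy1]; exact one_ne_zero)
  have hJxy : ⟪J x, y⟫ = c := by
    rw [← inner_starProjection_of_mem hy, hJx, real_inner_smul_left, real_inner_self_eq_norm_sq, hy1]
    ring
  have hJxIy : ⟪J x, I y⟫ = 0 := by
    rw [← inner_starProjection_of_mem (hb.apply_mem y hy), hJx, real_inner_smul_left,
      h.inner_I_self, mul_zero]
  have hz : s • s⁻¹ • (y - c • J x) = y - c • J x := smul_inv_smul₀ hs.ne' _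
  refine ⟨x, hx, s⁻¹ • (y - c • J x), ?_, hx1, ?_, ?_, ?_⟩
  · exact Submodule.smul_mem _ _ (Submodule.sub_mem _ (Submodule.mem_sup_left hy)
      (Submodule.smul_mem _ _ (Submodule.mem_sup_right ⟨x, hx, rfl⟩)))
  · have hn : ‖y - c • J x‖ ^ 2 = s ^ 2 := by
      rw [norm_sub_sq_real, real_inner_smul_right, real_inner_comm, hJxy, norm_smul, h.norm_J, hx1,
        hy1, mul_one, Real.norm_eq_abs, sq_abs]
      linarith
    rw [norm_smul, (sq_eq_sq₀ (norm_nonneg _) hs.le).1 hn, norm_inv, Real.norm_of_nonneg hs.le,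
      inv_mul_cancel₀ hs.ne']
  · apply h.quatPerp_of_inner_quatFrame
    have hxJ := h.inner_J_self x
    have hxIJ := h.inner_I_J_self x
    have hIxy : ⟪I x, y⟫ = 0 := by rw [h.skewI, hxIy, neg_zero]
    have hIxJx : ⟪I x, J x⟫ = 0 := by rw [h.skewI, hxIJ, neg_zero]
    have hIJxy : ⟪I (J x), y⟫ = 0 := by rw [h.skewI, hJxIy, neg_zero]
    have hIJxJx : ⟪I (J x), J x⟫ = 0 := by rw [real_inner_comm, h.inner_I_self]
    have hJx1 : ‖J x‖ = 1 := by rw [h.norm_J, hx1]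
    intro a
    fin_cases a <;>
      simp [quatFrame, real_inner_smul_right, inner_sub_right, hxy, hxJ, hIxy, hIxJx, hJxy, hJx1,
        hIJxy, hIJxJx]
  · rw [hz, add_sub_cancel]
    refine (Submodule.eq_of_le_of_finrank_eq (sup_le (complexSpan_le hb.apply_mem hx)
      (complexSpan_le hb.apply_mem hy)) ?_).symm
    rw [h.finrank_complexSpan_sup hx0 hy0 hxy hxIy, hdim]

/-- `v i false` and `v i true` are the vectors `x` and `z` of block `i`. The extra plane has no `z`:
the subtype omits that index and the value `0` keeps the formula for `W i` valid, as `cos (π/2) =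
0`. -/
theorem IsBlockDecomposition.exists_frame {Q : Submodule ℝ (Module.End ℝ V)}
    (h : IsAdaptedTo Q I J) {m : ℕ} {U : Submodule ℝ V} {θ : Fin ((m + 1) / 2) → ℝ}
    {W : Fin ((m + 1) / 2) → Submodule ℝ V} (H : IsBlockDecomposition I J m U θ W)
    (hp : ∀ i : Fin ((m + 1) / 2), (i : ℕ) < m / 2 → IsPure Q (W i)) :
    ∃ v : Fin ((m + 1) / 2) → Bool → V,
      (∀ i : Fin ((m + 1) / 2), m / 2 ≤ (i : ℕ) → v i true = 0) ∧
      (IsQuatOrthonormal I J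
        fun p : {p : Fin ((m + 1) / 2) × Bool // p.2 = true → (p.1 : ℕ) < m / 2} => v p.1.1 p.1.2) ∧
      ∀ i, W i = complexSpan I (v i false) ⊔
        complexSpan I (Real.cos (θ i) • J (v i false) + Real.sin (θ i) • v i true) := by
  have key : ∀ i : Fin ((m + 1) / 2), ∃ v : Bool → V, (∀ b, v b ∈ W i ⊔ (W i).map J) ∧
      ‖v false‖ = 1 ∧ ((i : ℕ) < m / 2 → ‖v true‖ = 1 ∧ QuatPerp I J (v false) (v true)) ∧
      (m / 2 ≤ (i : ℕ) → v true = 0) ∧ W i = complexSpan I (v false) ⊔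
        complexSpan I (Real.cos (θ i) • J (v false) + Real.sin (θ i) • v true) := by
    intro i
    have hdim := H.finrank_eq i
    split_ifs at hdim with hi
    · obtain ⟨x, hx, z, hz, hx1, hz1, hxz, hWi⟩ :=
        h.exists_frame (H.mem_Icc i) (H.block i) (hp i hi) hdim
      refine ⟨fun b => bif b then z else x, ?_, hx1, fun _ => ⟨hz1, hxz⟩, fun hi' => by omega, hWi⟩
      rintro (_ | _)
      · exact Submodule.mem_sup_left hx
      · exact hz
    · obtain ⟨x, hx, hx1, hWi⟩ := h.exists_generator (H.block i).apply_mem hdim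
      refine ⟨fun b => bif b then 0 else x, ?_, hx1, fun hi' => absurd hi' hi, fun _ => rfl, ?_⟩
      · rintro (_ | _)
        · exact Submodule.mem_sup_left hx
        · exact Submodule.zero_mem _
      · rw [H.last_eq i (not_lt.1 hi)]
        simpa [complexSpan_zero] using hWi
  choose v hmem hx1 hz hz0 hWv using key
  refine ⟨v, hz0, ⟨?_, ?_⟩, hWv⟩
  · rintro ⟨⟨i, _ | _⟩, hi⟩
    · exact hx1 i
    · exact (hz i (hi rfl)).1
  · rintro ⟨⟨i, a⟩, hi⟩ ⟨⟨j, b⟩, hj⟩ hne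
    rcases eq_or_ne i j with rfl | hij
    · rcases a with _ | _ <;> rcases b with _ | _
      · exact absurd rfl hne
      · exact (hz i (hj rfl)).2
      · exact h.quatPerp_symm (hz i (hi rfl)).2
      · exact absurd rfl hne
    · exact h.quatPerp_of_mem_sup_map (H.block j).apply_mem (H.inner_eq_zero i j hij)
        (H.inner_J_eq_zero i j hij) (hmem i a) (hmem j b)

theorem IsBlockDecomposition.exists_mem_Sp {Q : Submodule ℝ (Module.End ℝ V)}
    (h : IsAdaptedTo Q I J) {n m : ℕ} (hV : Module.finrank ℝ V = 4 * n) {U U' : Submodule ℝ V}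
    {θ : Fin ((m + 1) / 2) → ℝ} {W W' : Fin ((m + 1) / 2) → Submodule ℝ V}
    (H : IsBlockDecomposition I J m U θ W) (H' : IsBlockDecomposition I J m U' θ W')
    (hp : ∀ i : Fin ((m + 1) / 2), (i : ℕ) < m / 2 → IsPure Q (W i))
    (hp' : ∀ i : Fin ((m + 1) / 2), (i : ℕ) < m / 2 → IsPure Q (W' i)) :
    ∃ g ∈ Sp Q, U.map (g.toLinearEquiv : V →ₗ[ℝ] V) = U' := by
  classical
  obtain ⟨v, hz, hv, hW⟩ := H.exists_frame h hp
  obtain ⟨v', hz', hv', hW'⟩ := H'.exists_frame h hp'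
  have hle := hv.four_mul_card_le h.toIsAdaptedPair
  obtain ⟨g, hgI, hgJ, hg⟩ := hv.exists_isometry h.toIsAdaptedPair
    -- Number of vectors missing from a quaternionic basis; `hle` ensures that the subtraction does
    -- not truncate.
    (n - Fintype.card {p : Fin ((m + 1) / 2) × Bool // p.2 = true → (p.1 : ℕ) < m / 2}) hv'
    (by omega)
  have hgx : ∀ i, g (v i false) = v' i false := fun i => hg ⟨(i, false), fun hb => by simp at hb⟩
  have hgz : ∀ i, g (v i true) = v' i true := fun i => by
    rcases lt_or_ge (i : ℕ) (m / 2) with hi | hi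
    · exact hg ⟨(i, true), fun _ => hi⟩
    · rw [hz i hi, hz' i hi, map_zero]
  refine ⟨g, h.mem_Sp_iff.2 ⟨hgI, hgJ⟩, ?_⟩
  rw [← H.iSup_eq, ← H'.iSup_eq, Submodule.map_iSup]
  refine iSup_congr fun i => ?_
  rw [hW, hW', Submodule.map_sup, map_complexSpan (fun x => hgI x), map_complexSpan (fun x => hgI x)]
  simp [hgx, hgz, hgJ]

end Transitivity

/-! ### Invariance under `Sp(n)` and the orbit. -/

section Invariance

variable {V : Type*} [NormedAddCommGroup V] [InnerProductSpace ℝ V] [FiniteDimensional ℝ V]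
  {I J : Module.End ℝ V} {Q : Submodule ℝ (Module.End ℝ V)}

theorem IsBlock.map (h : IsAdaptedTo Q I J) {c : ℝ} {W : Submodule ℝ V} (hb : IsBlock I J c W)
    {g : V ≃ₗᵢ[ℝ] V} (hg : g ∈ Sp Q) : IsBlock I J c (W.map (g.toLinearEquiv : V →ₗ[ℝ] V)) := by
  obtain ⟨hgI, hgJ⟩ := h.mem_Sp_iff.1 hg
  constructor
  · rintro _ ⟨x, hx, rfl⟩
    exact ⟨I x, hb.apply_mem x hx, hgI x⟩
  · rintro _ ⟨x, hx, rfl⟩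
    change ‖(W.map (g.toLinearEquiv : V →ₗ[ℝ] V)).starProjection (J (g x))‖ = c * ‖g x‖
    rw [Submodule.starProjection_map_apply, ← hgJ, g.symm_apply_apply, g.norm_map, g.norm_map,
      hb.norm_proj x hx]

theorem IsBlockDecomposition.map (h : IsAdaptedTo Q I J) {m : ℕ} {U : Submodule ℝ V}
    {θ : Fin ((m + 1) / 2) → ℝ} {W : Fin ((m + 1) / 2) → Submodule ℝ V}
    (H : IsBlockDecomposition I J m U θ W) {g : V ≃ₗᵢ[ℝ] V} (hg : g ∈ Sp Q) :
    IsBlockDecomposition I J m (U.map (g.toLinearEquiv : V →ₗ[ℝ] V)) θ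
      fun i => (W i).map (g.toLinearEquiv : V →ₗ[ℝ] V) where
  block i := (H.block i).map h hg
  mem_Icc := H.mem_Icc
  finrank_eq i := by rw [LinearEquiv.finrank_map_eq, H.finrank_eq]
  last_eq := H.last_eq
  inner_eq_zero := by
    rintro i j hij _ ⟨x, hx, rfl⟩ _ ⟨y, hy, rfl⟩
    exact (g.inner_map_map x y).trans (H.inner_eq_zero i j hij x hx y hy)
  inner_J_eq_zero := by
    rintro i j hij _ ⟨x, hx, rfl⟩ _ ⟨y, hy, rfl⟩
    change ⟪g x, J (g y)⟫ = 0
    rw [← (h.mem_Sp_iff.1 hg).2, g.inner_map_map, H.inner_J_eq_zero i j hij x hx y hy]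
  iSup_eq := by rw [← Submodule.map_iSup, H.iSup_eq]

theorem IsAdaptedTo.map_mem_multipleangleGr (h : IsAdaptedTo Q I J) {m : ℕ} {U : Submodule ℝ V}
    {θ : Fin ((m + 1) / 2) → ℝ} (hU : U ∈ multipleangleGr Q I m θ) {g : V ≃ₗᵢ[ℝ] V}
    (hg : g ∈ Sp Q) : U.map (g.toLinearEquiv : V →ₗ[ℝ] V) ∈ multipleangleGr Q I m θ := by
  obtain ⟨⟨hdim, hp, hc⟩, hang⟩ := hU
  obtain ⟨hmono, W, H, hpW⟩ := h.isMultipleangle_iff.1 hang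
  refine ⟨⟨by rw [LinearEquiv.finrank_map_eq, hdim], hp.map hg, ?_⟩,
    h.isMultipleangle_iff.2 ⟨hmono, _, H.map h hg, fun i hi => (hpW i hi).map hg⟩⟩
  rw [isComplex_iff h.II]
  rintro _ ⟨x, hx, rfl⟩
  exact ⟨I x, (isComplex_iff h.II).1 hc x hx, (h.mem_Sp_iff.1 hg).1 x⟩

theorem IsAdaptedTo.spOrbit_eq (h : IsAdaptedTo Q I J) {n m : ℕ}
    (hV : Module.finrank ℝ V = 4 * n) {U : Submodule ℝ V} {θ : Fin ((m + 1) / 2) → ℝ}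
    (hU : U ∈ multipleangleGr Q I m θ) : spOrbit Q U = multipleangleGr Q I m θ := by
  apply Set.Subset.antisymm
  · rintro _ ⟨g, hg, rfl⟩
    exact h.map_mem_multipleangleGr hU hg
  · intro U' hU'
    obtain ⟨-, W, H, hp⟩ := h.isMultipleangle_iff.1 hU.2
    obtain ⟨-, W', H', hp'⟩ := h.isMultipleangle_iff.1 hU'.2
    exact H.exists_mem_Sp h hV H' hp hp'

end Invariance

end HermQuat

/-- Every `2m`-dimensional pure `I`-complex subspace has a well-defined `I^⊥`-Kähler
multipleangle, and the set of all such subspaces with a given multipleangle is a single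
`Sp(n)`-orbit. -/
theorem mainTheorem1 {V : Type*} [NormedAddCommGroup V] [InnerProductSpace ℝ V]
    [FiniteDimensional ℝ V] (n : ℕ) (hV : Module.finrank ℝ V = 4 * n)
    (Q : Submodule ℝ (Module.End ℝ V)) (hQ : HermQuat.IsHermitianQuaternionic Q)
    (I : Module.End ℝ V) (hI : I ∈ HermQuat.complexStructures Q) (m : ℕ) :
    (∀ U ∈ HermQuat.pureComplexGr Q I m,
      ∃! θ : Fin ((m + 1) / 2) → ℝ, HermQuat.IsMultipleangle Q I m U θ) ∧
    (∀ θ : Fin ((m + 1) / 2) → ℝ, ∀ U ∈ HermQuat.multipleangleGr Q I m θ,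
      HermQuat.spOrbit Q U = HermQuat.multipleangleGr Q I m θ) := by
  -- The choice of `J` is harmless: neither conclusion mentions it.
  obtain ⟨J, h⟩ := HermQuat.exists_isAdaptedTo hQ hI
  exact ⟨fun _ hU => h.existsUnique_isMultipleangle hU, fun _ _ hU => h.spOrbit_eq hV hU⟩
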